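/- **Problem.** Let $T\ge 1$, $\lambda\in(0,1]$. For $t=1,\dots,T$ let $\bar X_t\subseteq\mathbb R^{n_t}$ be closed and convex, let $\phi_{t,i}:\bar X_t\to\mathbb R$ ($i=1,\dots,p_t$) be closed convex functions, let $h_t:\mathbb R^{n_t}\to(-\infty,+\infty]$ be a closed convex function that is finite on $\bar X_t$, let $A_t,B_t,Q_t$ be linear maps and $b_t$ vectors, and put $$X_t(x_{t-1})=\{x\in\bar X_t:\ A_tx=B_tx_{t-1}+b_t,\ \phi_t(x)\le Q_tx_{t-1}\},$$ where $B_1=0$, $Q_1=0$, so that $X_1(x_0)\equiv X_1$. Let $v_{T+1}\equiv0$ and, backwards in $t$, $f_t=h_t+\lambda v_{t+1}$ and $v_t(x_{t-1})=\min\{f_t(x):x\in X_t(x_{t-1})\}$; the problem is $f^*=\min_{x_1\in X_1}f_1(x_1)$. Let $\mathcal X_1=X_1$ and $\mathcal X_t=\bigcup_{x\in\mathcal X_{t-1}}X_t(x)$ for $t\ge2$. All norms are $\ell_\infty$ norms. **Assumptions.** For $1\le t\le T$: (1) $D_t\ge0$ and $\|x-x'\|\le D_t$ for all $x,x'\in\mathcal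 X_t$; (2) there is $\bar\epsilon_t>0$ such that every $x=z+d$ with $z\in\mathcal X_t$, $\|d\|\le\bar\epsilon_t$ and $d$ in the linear space parallel to the affine hull of $\mathcal X_t$ satisfies $h_t(x)<\infty$ and, if $t<T$, $X_{t+1}(x)$ has nonempty relative interior; (3) $M_t\ge0$ and $f_t$ is finite and $M_t$-Lipschitz on $\mathcal X_t$. **DDP.** Start with $\underline v_t^0\equiv-\infty$ for $2\le t\le T$, and put $\underline v_{T+1}^k\equiv0$ for all $k\ge0$. In iteration $k=1,2,\dots$, write $\underline f_t^{k}=h_t+\lambda\underline v_{t+1}^{k}$. *Forward phase,* $t=1,\dots,T$: choose $x_t^k\in\operatorname{Argmin}\{\underline f_t^{k-1}(x):x\in X_t(x_{t-1}^k)\}$. *Backward phase,* $t=T,\dots,2$: let $\tilde v_t^k=\min\{\underline f_t^k(x):x\in X_t(x_{t-1}^k)\}$, let $y_t^k=(\mu,\nu)$ be an optimal dual multiplier of this problem, that is, $\nu\le0$ and $$\inf_{x\in\bar X_t}\{\underline f_t^k(x)+\langle\mu,B_tx_{t-1}^k+b_t-A_tx\rangle+\langle\nu,Q_tx_{t-1}^k-\phi_t(x)\rangle\}=\tilde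 v_t^k,$$ and set $\underline v_t^k(x)=\max\{\underline v_t^{k-1}(x),\ \tilde v_t^k+\langle\mu,B_t(x-x_{t-1}^k)\rangle+\langle\nu,Q_t(x-x_{t-1}^k)\rangle\}$. **Theorem.** For every run of DDP the following holds. For each $1\le t\le T$ there is a constant $\underline M_t\ge0$ such that $\underline f_t^k$ is finite and $\underline M_t$-Lipschitz on $\mathcal X_t$ for all $k\ge1$. Moreover, for any such constants: (a) Given $\delta_t>0$ ($1\le t\le T-1$), define $\epsilon_{T-1}=0$ and $\epsilon_t=\sum_{\tau=t}^{T-2}(M_{\tau+1}+\underline M_{\tau+1})\delta_{\tau+1}\lambda^{\tau-t}$ for $0\le t\le T-2$; equivalently $\epsilon_{t-1}=(M_t+\underline M_t)\delta_t+\lambda\epsilon_t$. Then within at most $$\sum_{t=1}^{T-1}\Bigl(\frac{D_t}{\delta_t}+1\Bigr)^{n_t}+1$$ iterations, DDP finds a feasible policy $(x_1^k,\dots,x_T^k)$ with $$f_1(x_1^k)-f^*\le\epsilon_0,\qquad \sum_{t=1}^T\lambda^{t-1}h_t(x_t^k)-\underline f_1^{k-1}(x_1^k)\le\sum_{t=1}^T\lambda^{t-1}\epsilon_{t-1}.$$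 (b) If $n_t\le n$, $D_t\le D$, $\max\{M_t,\underline M_t\}\le M$ for all $1\le t\le T$, and $\epsilon>0$, then within at most $(T-1)(D/\epsilon+1)^n+1$ iterations, DDP finds a feasible policy $(x_1^k,\dots,x_T^k)$ with $$f_1(x_1^k)-f^*\le2M\min\Bigl\{\frac1{1-\lambda},\,T-1\Bigr\}\epsilon,$$ $$\sum_{t=1}^T\lambda^{t-1}h_t(x_t^k)-\underline f_1^{k-1}(x_1^k)\le2M\min\Bigl\{\frac1{(1-\lambda)^2},\,\frac{T(T-1)}2\Bigr\}\epsilon,$$ where $1/0=+\infty$ when $\lambda=1$. -/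

import Mathlib

open Set

namespace DDP

/-- `{(z, r) | z ∈ S, g z ≤ r}`, the epigraph of a real function `g` with domain `S`.  A function
with domain `S` is closed when this set is closed. -/
def epigraphOn {E : Type*} (S : Set E) (g : E → ℝ) : Set (E × ℝ) :=
  {q | q.1 ∈ S ∧ g q.1 ≤ q.2}

/-- The data of a single-scenario `T`-stage convex problem.  The decision of stage `t` lives in
`Fin (n t) → ℝ`, which carries the sup norm; only the stages `1, …, T` enter the problem.

The two maps that feed the decision of stage `t` into the constraints of stage `t + 1` are indexed
by `t`: `B t` and `Q t` are what is usually written `B_{t+1}` and `Q_{t+1}`.  Stage `0` is a dummy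
stage (`B 0 = 0`, `Q 0 = 0`), so that the first feasible set does not depend on a previous
decision.

The function `h t` is a closed convex function which is finite on `hdom t ⊇ Xbar t` and `+∞`
elsewhere; the values of the Lean function `h t` outside `hdom t` are irrelevant. -/
structure Problem where
  T : ℕ
  one_le_T : 1 ≤ T
  lam : ℝ
  lam_pos : 0 < lam
  lam_le_one : lam ≤ 1
  n : ℕ → ℕ
  m : ℕ → ℕ
  p : ℕ → ℕ
  Xbar : ∀ t, Set (Fin (n t) → ℝ)
  Xbar_closed : ∀ t, IsClosed (Xbar t)
  Xbar_convex : ∀ t, Convex ℝ (Xbar t)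
  A : ∀ t, (Fin (n t) → ℝ) →ₗ[ℝ] (Fin (m t) → ℝ)
  b : ∀ t, Fin (m t) → ℝ
  B : ∀ t, (Fin (n t) → ℝ) →ₗ[ℝ] (Fin (m (t + 1)) → ℝ)
  Q : ∀ t, (Fin (n t) → ℝ) →ₗ[ℝ] (Fin (p (t + 1)) → ℝ)
  B_zero : B 0 = 0
  Q_zero : Q 0 = 0
  phi : ∀ t, (Fin (n t) → ℝ) → Fin (p t) → ℝ
  phi_convex : ∀ t i, ConvexOn ℝ (Xbar t) (fun z => phi t z i)
  phi_closed : ∀ t i, IsClosed (epigraphOn (Xbar t) (fun z => phi t z i))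
  hdom : ∀ t, Set (Fin (n t) → ℝ)
  h : ∀ t, (Fin (n t) → ℝ) → ℝ
  Xbar_subset_hdom : ∀ t, Xbar t ⊆ hdom t
  h_convex : ∀ t, ConvexOn ℝ (hdom t) (h t)
  h_closed : ∀ t, IsClosed (epigraphOn (hdom t) (h t))

namespace Problem

variable (P : Problem)

/-- The decision space of stage `t`, with the `l_∞` norm. -/
abbrev Dec (t : ℕ) : Type := Fin (P.n t) → ℝ

/-- `X_{t+1}(z)`: the decisions of stage `t + 1` that are feasible after decision `z` at
stage `t`. -/
def feas (t : ℕ) (z : P.Dec t) : Set (P.Dec (t + 1)) :=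
  {w | w ∈ P.Xbar (t + 1) ∧ P.A (t + 1) w = P.B t z + P.b (t + 1) ∧
    ∀ i, P.phi (t + 1) w i ≤ P.Q t z i}

/-- The effective feasible region of stage `t`.  The value at the dummy stage `0` is immaterial,
because `feas 0 z` does not depend on `z`. -/
def effFeas : (t : ℕ) → Set (P.Dec t)
  | 0 => univ
  | t + 1 => ⋃ z ∈ effFeas t, P.feas t z

/-- The effective feasible region of stage `t` together with a neighborhood of radius `e` along
its affine hull. -/
def effFeasNhd (t : ℕ) (e : ℝ) : Set (P.Dec t) :=
  {w | ∃ z ∈ P.effFeas t, ∃ d ∈ vectorSpan ℝ (P.effFeas t), ‖d‖ ≤ e ∧ w = z + d}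

/-- Optimal cost of the next `r` stages after decision `z` at stage `t`. -/
noncomputable def valueAux : (r : ℕ) → (t : ℕ) → P.Dec t → EReal
  | 0, _, _ => 0
  | r + 1, t, z => ⨅ w ∈ P.feas t z, ((P.h (t + 1) w : EReal) + (P.lam : EReal) *
      valueAux r (t + 1) w)

/-- The value function `v_{t+1}`, a function of the decision of stage `t`. -/
noncomputable def value (t : ℕ) (z : P.Dec t) : EReal := P.valueAux (P.T - t) t z

/-- `h_t + λ V` for a function `V` of the decision of stage `t`. -/
noncomputable def objWith (t : ℕ) (V : P.Dec t → EReal) (z : P.Dec t) : EReal :=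
  (P.h t z : EReal) + (P.lam : EReal) * V z

/-- The stage objective `f_t = h_t + λ v_{t+1}`. -/
noncomputable def obj (t : ℕ) : P.Dec t → EReal := P.objWith t (P.value t)

/-- The optimal value `f^* = min {f_1(x) : x ∈ X_1}`. -/
noncomputable def optVal : EReal := ⨅ w ∈ P.feas 0 0, P.obj 1 w

theorem value_last (z : P.Dec P.T) : P.value P.T z = 0 := by
  simp [value, valueAux]

theorem value_of_lt {t : ℕ} (ht : t < P.T) (z : P.Dec t) :
    P.value t z = ⨅ w ∈ P.feas t z, P.obj (t + 1) w := by
  have h : P.T - t = (P.T - (t + 1)) + 1 := by omega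
  unfold value obj objWith
  rw [h]
  rfl

/-- `D t` bounds the `l_∞` diameter of the effective feasible region of stage `t`. -/
def DiameterBound (D : ℕ → ℝ) : Prop :=
  ∀ t, 1 ≤ t → t ≤ P.T → 0 ≤ D t ∧
    ∀ z ∈ P.effFeas t, ∀ w ∈ P.effFeas t, ‖z - w‖ ≤ D t

/-- Extended relatively complete recourse: near the effective feasible region of each stage, the
stage cost is finite and the next feasible set has a nonempty relative interior. -/
def ExtendedRecourse : Prop :=
  ∀ t, 1 ≤ t → t ≤ P.T → ∃ e : ℝ, 0 < e ∧ ∀ z ∈ P.effFeasNhd t e,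
    z ∈ P.hdom t ∧ (t < P.T → (intrinsicInterior ℝ (P.feas t z)).Nonempty)

end Problem

/-- The extended-real function `F` is finite and `M`-Lipschitz on `S`. -/
def FiniteLipschitzOn {E : Type*} [Norm E] [Sub E] (F : E → EReal) (S : Set E) (M : ℝ) : Prop :=
  ∃ g : E → ℝ, (∀ z ∈ S, F z = (g z : EReal)) ∧
    ∀ z ∈ S, ∀ w ∈ S, |g z - g w| ≤ M * ‖z - w‖

namespace Problem

variable (P : Problem)

/-- `M t` is a Lipschitz constant of the stage objective `f_t` on the effective feasible region. -/
def ObjLipschitz (M : ℕ → ℝ) : Prop :=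
  ∀ t, 1 ≤ t → t ≤ P.T → 0 ≤ M t ∧ FiniteLipschitzOn (P.obj t) (P.effFeas t) (M t)

/-- Minimum of the stage-`(t+1)` problem with objective `F` after decision `z` at stage `t`. -/
noncomputable def subVal (t : ℕ) (F : P.Dec (t + 1) → EReal) (z : P.Dec t) : EReal :=
  ⨅ w ∈ P.feas t z, F w

/-- `(mu, nu)` is an optimal dual multiplier of the problem
`min {F w : w ∈ Xbar, A w = B z + b, phi w ≤ Q z}`: the infimum over `Xbar` of the Lagrangian
`F w + ⟨mu, B z + b - A w⟩ + ⟨nu, Q z - phi w⟩`, where `nu ≤ 0`, is the optimal value. -/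
def IsDualMultiplier (t : ℕ) (F : P.Dec (t + 1) → EReal) (z : P.Dec t)
    (mu : Fin (P.m (t + 1)) → ℝ) (nu : Fin (P.p (t + 1)) → ℝ) : Prop :=
  (∀ i, nu i ≤ 0) ∧
    (⨅ w ∈ P.Xbar (t + 1), (F w +
      ((mu ⬝ᵥ (P.B t z + P.b (t + 1) - P.A (t + 1) w) +
        nu ⬝ᵥ (P.Q t z - P.phi (t + 1) w) : ℝ) : EReal))) = P.subVal t F z

/-- A run of the dual dynamic programming method.  Iterations are numbered `1, 2, …`, and
* `x k t` is the search point of stage `t` in iteration `k`;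
* `vlow k t` is the cutting plane model of the value function `v_{t+1}` (a function of the decision
  of stage `t`) after iteration `k`;
* `mu k t, nu k t` is the dual multiplier computed in iteration `k` for the problem of
  stage `t + 1` at `x k t`. -/
structure IsRun (x : ℕ → ∀ t, P.Dec t) (vlow : ℕ → ∀ t, P.Dec t → EReal)
    (mu : ℕ → ∀ t, Fin (P.m (t + 1)) → ℝ) (nu : ℕ → ∀ t, Fin (P.p (t + 1)) → ℝ) : Prop where
  /-- Initially the models are `-∞`. -/
  init : ∀ t, 1 ≤ t → t < P.T → ∀ z, vlow 0 t z = ⊥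
  /-- There is no cost after the last stage. -/
  last : ∀ k z, vlow k P.T z = 0
  /-- Forward phase of iteration `k + 1`, stage `t + 1`: feasibility. -/
  forward_mem : ∀ k t, t < P.T → x (k + 1) (t + 1) ∈ P.feas t (x (k + 1) t)
  /-- Forward phase of iteration `k + 1`, stage `t + 1`: minimality for the previous models. -/
  forward_min : ∀ k t, t < P.T →
    IsMinOn (P.objWith (t + 1) (vlow k (t + 1))) (P.feas t (x (k + 1) t)) (x (k + 1) (t + 1))
  /-- Backward phase of iteration `k + 1`: dual multipliers for the updated models. -/
  dual : ∀ k t, 1 ≤ t → t < P.T →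
    P.IsDualMultiplier t (P.objWith (t + 1) (vlow (k + 1) (t + 1))) (x (k + 1) t)
      (mu (k + 1) t) (nu (k + 1) t)
  /-- Backward phase of iteration `k + 1`: the new cut, with slope given by `[B, Q]` applied to the
  multiplier, is added to the model. -/
  backward : ∀ k t, 1 ≤ t → t < P.T → ∀ z,
    vlow (k + 1) t z = max (vlow k t z)
      (P.subVal t (P.objWith (t + 1) (vlow (k + 1) (t + 1))) (x (k + 1) t) +
        ((mu (k + 1) t ⬝ᵥ P.B t (z - x (k + 1) t) +
          nu (k + 1) t ⬝ᵥ P.Q t (z - x (k + 1) t) : ℝ) : EReal))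

/-- `Mlow t` is, for all iterations `k ≥ 1`, a Lipschitz constant on the effective feasible region
of the model objective `h_t + λ vlow k t`. -/
def ModelLipschitz (vlow : ℕ → ∀ t, P.Dec t → EReal) (Mlow : ℕ → ℝ) : Prop :=
  ∀ t, 1 ≤ t → t ≤ P.T → 0 ≤ Mlow t ∧
    ∀ k, 1 ≤ k → FiniteLipschitzOn (P.objWith t (vlow k t)) (P.effFeas t) (Mlow t)

/-- `ε_t = ∑_{τ=t}^{T-2} (M_{τ+1} + Mlow_{τ+1}) δ_{τ+1} λ^{τ-t}` for `t ≤ T - 2`, and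
`ε_{T-1} = 0`. -/
noncomputable def eps (M Mlow δ : ℕ → ℝ) (t : ℕ) : ℝ :=
  ∑ τ ∈ Finset.Ico t (P.T - 1), (M (τ + 1) + Mlow (τ + 1)) * δ (τ + 1) * P.lam ^ (τ - t)

/-- `(z_1, …, z_T)` is a feasible policy. -/
def FeasiblePolicy (z : ∀ t, P.Dec t) : Prop :=
  ∀ t, t < P.T → z (t + 1) ∈ P.feas t (z t)

/-- Total discounted cost of `(z_1, …, z_T)`. -/
noncomputable def policyCost (z : ∀ t, P.Dec t) : ℝ :=
  ∑ t ∈ Finset.Icc 1 P.T, P.lam ^ (t - 1) * P.h t (z t)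

/-- Iteration `k` finds a feasible policy with optimality gap at most `g` and with gap between the
upper bound `∑ λ^{t-1} h_t(x_t^k)` and the lower bound (the optimal value of the first-stage model
problem of iteration `k`) at most `g'`. -/
def FindsPolicy (x : ℕ → ∀ t, P.Dec t) (vlow : ℕ → ∀ t, P.Dec t → EReal) (k : ℕ) (g g' : ℝ) :
    Prop :=
  P.FeasiblePolicy (x k) ∧
    P.obj 1 (x k 1) - P.optVal ≤ (g : EReal) ∧
    (P.policyCost (x k) : EReal) - P.objWith 1 (vlow (k - 1) 1) (x k 1) ≤ (g' : EReal)

end Problem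

/-- `min {1 / (1 - l)^q, c}`, where `1 / 0 = +∞`. -/
noncomputable def discountMin (l : ℝ) (q : ℕ) (c : ℝ) : ℝ :=
  if l = 1 then c else min (1 / (1 - l) ^ q) c

end DDP

/-! Two arguments are combined.

Uniform Lipschitz constants. From iteration 1 on, each model is a maximum of finitely many affine
functions, hence real and convex. A family of convex functions that is bounded above pointwise in a
neighbourhood of a compact set, and bounded below by one member, is uniformly Lipschitz on that set
(`ConvexOn.exists_uniform_lipschitz`). The neighbourhood is taken along the affine hull of the
effective region; `RelCore` records this and leaves directions off the hull aside. Boundedness above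
near the region follows backwards in the stages from extended recourse (`IsRun.relCore_bounded`),
compactness from closed graphs.

Iteration count. Models increase and stay below the true value functions. Call a search point
saturated if the model there is within `ε_t` of the value. A stage-`t` point within `δ_t` of an
earlier saturated one has objective gap at most `(M_t + Mlow_t) δ_t + λ ε_t = ε_{t-1}`
(`IsRun.objGapLE_of_close`), and this gap saturates the point of stage `t - 1`
(`IsRun.saturated_of_objGapLE`). So if closeness fails in an iteration, the last stage at which it
fails receives a new saturated point, more than `δ_t` from all earlier ones. By packing
(`card_le_of_separated`) stage `t` admits at most `(D_t / δ_t + 1) ^ n_t` of these. Once all stages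
are close, the stage-one gap bounds the optimality gap, and the discounted stage gaps telescope to
the bound on policy cost. -/

namespace DDP

/-! ### Convex functions near a compact set -/

/-- Every point of `S` can be moved inside `C` a little in every direction of the affine hull
of `S`. -/
def RelCore {E : Type*} [AddCommGroup E] [Module ℝ E] (S C : Set E) : Prop :=
  ∀ z ∈ S, ∀ d ∈ vectorSpan ℝ S, ∃ s : ℝ, 0 < s ∧ z + s • d ∈ C

theorem RelCore.subset {E : Type*} [AddCommGroup E] [Module ℝ E] {S C : Set E}
    (h : RelCore S C) : S ⊆ C := by
  intro z hz
  obtain ⟨s, -, hs⟩ := h z hz 0 (Submodule.zero_mem _)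
  simpa using hs

theorem Convex.add_smul_mem_of_le {E : Type*} [AddCommGroup E] [Module ℝ E] {C : Set E}
    (hC : Convex ℝ C) {z d : E} (hz : z ∈ C) {s s' : ℝ} (hs' : 0 ≤ s') (hss : s' ≤ s)
    (hzs : z + s • d ∈ C) : z + s' • d ∈ C := by
  rcases hs'.eq_or_lt with h0 | h0
  · simpa [← h0] using hz
  have hs : 0 < s := h0.trans_le hss
  have h := hC.add_smul_mem hz hzs (t := s' / s) ⟨by positivity, by rw [div_le_one hs]; exact hss⟩
  rwa [smul_smul, div_mul_cancel₀ _ hs.ne'] at h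

theorem RelCore.inter {E : Type*} [AddCommGroup E] [Module ℝ E] {S C C' : Set E}
    (h : RelCore S C) (h' : RelCore S C') (hC : Convex ℝ C) (hC' : Convex ℝ C') :
    RelCore S (C ∩ C') := by
  intro z hz d hd
  obtain ⟨s, hs, hzs⟩ := h z hz d hd
  obtain ⟨s', hs', hzs'⟩ := h' z hz d hd
  have h0 : 0 < min s s' := lt_min hs hs'
  exact ⟨min s s', h0, Convex.add_smul_mem_of_le hC (h.subset hz) h0.le (min_le_left _ _) hzs,
    Convex.add_smul_mem_of_le hC' (h'.subset hz) h0.le (min_le_right _ _) hzs'⟩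

/-- Absorption makes the affine span of `C` the whole space, so `C` has an interior point `a` in
finite dimension. Prolonging the segment from `a` beyond `z` inside `C` makes `z` an inner point of
a segment with one end in the interior. -/
theorem mem_interior_of_absorbs {E : Type*} [NormedAddCommGroup E] [NormedSpace ℝ E]
    [FiniteDimensional ℝ E] {C : Set E} (hC : Convex ℝ C) {z : E}
    (h : ∀ d : E, ∃ s : ℝ, 0 < s ∧ z + s • d ∈ C) : z ∈ interior C := by
  have hz : z ∈ C := by
    obtain ⟨s, -, hs⟩ := h 0
    simpa using hs
  have hspan : affineSpan ℝ C = ⊤ := by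
    rw [AffineSubspace.affineSpan_eq_top_iff_vectorSpan_eq_top_of_nonempty ℝ E E ⟨z, hz⟩]
    rw [eq_top_iff]
    intro d _
    obtain ⟨s, hs, hzs⟩ := h d
    have h1 := vsub_mem_vectorSpan ℝ hzs hz
    simp only [vsub_eq_sub, add_sub_cancel_left] at h1
    exact ((vectorSpan ℝ C).smul_mem_iff hs.ne').1 h1
  obtain ⟨a, ha⟩ := (hC.interior_nonempty_iff_affineSpan_eq_top).2 hspan
  obtain ⟨s, hs, hzs⟩ := h (z - a)
  refine hC.openSegment_interior_self_subset_interior ha hzs ?_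
  refine ⟨s / (1 + s), 1 / (1 + s), by positivity, by positivity, by field_simp; ring, ?_⟩
  have h1 : (1 + s) ≠ 0 := by positivity
  have h2 : s / (1 + s) = s * (1 / (1 + s)) := by ring
  have h3 : (1 : ℝ) / (1 + s) * (1 + s) = 1 := by field_simp
  rw [h2]
  generalize 1 / (1 + s) = c at h3
  have : (s * c) • a + c • (z + s • (z - a)) = (c * (1 + s)) • z := by module
  rw [this, h3, one_smul]

/-- A convex function is bounded on a neighbourhood, along the affine hull, of a compact set in the
relative core of its domain. -/
theorem ConvexOn.exists_bound_nhd {E : Type*} [NormedAddCommGroup E] [NormedSpace ℝ E]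
    [FiniteDimensional ℝ E] {S C : Set E} (hS : IsCompact S) (hSC : RelCore S C) {g : E → ℝ}
    (hg : ConvexOn ℝ C g) :
    ∃ r : ℝ, 0 < r ∧ ∃ K : ℝ, ∀ z ∈ S, ∀ d ∈ vectorSpan ℝ S, ‖d‖ ≤ r →
      z + d ∈ C ∧ |g (z + d)| ≤ K := by
  rcases S.eq_empty_or_nonempty with rfl | ⟨z0, hz0⟩
  · exact ⟨1, one_pos, 0, fun z hz => absurd hz (notMem_empty z)⟩
  set V := vectorSpan ℝ S with hV
  -- Coordinates on the affine hull of `S`: there the relative core becomes an honest interior, on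
  -- which convex functions are continuous.
  let φ : V →ᵃ[ℝ] E := V.subtype.toAffineMap + AffineMap.const ℝ V z0
  have hφ : ∀ l : V, φ l = l + z0 := fun l => rfl
  have hemb : Topology.IsClosedEmbedding φ := by
    have : (φ : V → E) = (Homeomorph.addRight z0) ∘ ((↑) : V → E) := by
      ext l; simp [hφ]
    rw [this]
    exact (Homeomorph.addRight z0).isClosedEmbedding.comp
      (Submodule.closed_of_finiteDimensional V).isClosedEmbedding_subtypeVal
  have hS' : IsCompact (φ ⁻¹' S) := hemb.isCompact_preimage hS
  have hC' : Convex ℝ (φ ⁻¹' C) := hg.1.affine_preimage φ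
  have hsub : φ ⁻¹' S ⊆ interior (φ ⁻¹' C) := by
    intro l hl
    refine mem_interior_of_absorbs hC' fun d => ?_
    obtain ⟨s, hs, h⟩ := hSC (φ l) hl d d.2
    refine ⟨s, hs, ?_⟩
    have : φ (l + s • d) = φ l + s • (d : E) := by
      simp only [hφ, Submodule.coe_add, Submodule.coe_smul]; abel
    rwa [mem_preimage, this]
  have hcont : ContinuousOn (g ∘ φ) (interior (φ ⁻¹' C)) :=
    (hg.comp_affineMap φ).continuousOn_interior
  obtain ⟨r, hr, hrC⟩ := hS'.exists_cthickening_subset_open isOpen_interior hsub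
  have hcomp : IsCompact (Metric.cthickening r (φ ⁻¹' S)) := hS'.cthickening
  obtain ⟨K, hK⟩ := hcomp.exists_bound_of_continuousOn (hcont.mono hrC)
  refine ⟨r, hr, K, fun z hz d hd hdr => ?_⟩
  let l : V := ⟨z - z0, vsub_mem_vectorSpan ℝ hz hz0⟩
  have hl : φ l = z := by simp [hφ, l]
  have hld : φ (l + ⟨d, hd⟩) = z + d := by
    simp only [hφ, l, Submodule.coe_add]; abel
  have hmem : l + ⟨d, hd⟩ ∈ Metric.cthickening r (φ ⁻¹' S) := by
    refine Metric.mem_cthickening_of_dist_le _ l _ _ (by rw [mem_preimage, hl]; exact hz) ?_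
    rw [dist_eq_norm, add_sub_cancel_left]
    exact hdr
  have h1 := interior_subset (hrC hmem)
  have h2 := hK _ hmem
  rw [mem_preimage, hld] at h1
  rw [Function.comp_apply, hld, Real.norm_eq_abs] at h2
  exact ⟨h1, h2⟩

/-- A pointwise bounded family of convex functions is uniformly Lipschitz on a compact set in the
relative core of the common domain. -/
theorem ConvexOn.exists_uniform_lipschitz {E : Type*} [NormedAddCommGroup E] [NormedSpace ℝ E]
    [FiniteDimensional ℝ E] {S C : Set E} (hS : IsCompact S) (hSC : RelCore S C) {ι : Type*}
    [Nonempty ι] {g : ι → E → ℝ} (hg : ∀ i, ConvexOn ℝ C (g i)) {i0 : ι}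
    (h0 : ∀ i, ∀ z, g i0 z ≤ g i z) (hbdd : ∀ z ∈ C, BddAbove (range fun i => g i z)) :
    ∃ L : ℝ, 0 ≤ L ∧ ∀ i, ∀ z ∈ S, ∀ w ∈ S, |g i z - g i w| ≤ L * ‖z - w‖ := by
  have hG : ConvexOn ℝ C (fun z => ⨆ i, g i z) := by
    refine ⟨(hg i0).1, fun z hz w hw a b ha hb hab => ciSup_le fun i => ?_⟩
    refine ((hg i).2 hz hw ha hb hab).trans ?_
    simp only [smul_eq_mul]
    gcongr
    · exact le_ciSup (hbdd z hz) i
    · exact le_ciSup (hbdd w hw) i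
  obtain ⟨r, hr, K, hK⟩ := ConvexOn.exists_bound_nhd hS hSC hG
  obtain ⟨r', hr', K', hK'⟩ := ConvexOn.exists_bound_nhd hS hSC (hg i0)
  -- Pass from `w` through `z` to the point at distance `r` beyond `z`. There the supremum of the
  -- family gives the upper bound `|K|`, while `g i0` gives the lower bound `-|K'|` at `z`;
  -- convexity along this segment yields the slope.
  have key : ∀ i, ∀ z ∈ S, ∀ w ∈ S, g i z - g i w ≤ ((|K| + |K'|) / r) * ‖z - w‖ := by
    intro i z hz w hw
    rcases eq_or_ne z w with rfl | hne
    · simp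
    have hpos : 0 < ‖z - w‖ := norm_pos_iff.2 (sub_ne_zero.2 hne)
    set ρ := ‖z - w‖ with hρ
    have hd : (r / ρ) • (z - w) ∈ vectorSpan ℝ S :=
      Submodule.smul_mem _ _ (vsub_mem_vectorSpan ℝ hz hw)
    have hdn : ‖(r / ρ) • (z - w)‖ ≤ r := by
      rw [norm_smul, Real.norm_eq_abs, abs_of_pos (by positivity), ← hρ]
      exact (div_mul_cancel₀ _ hpos.ne').le
    obtain ⟨huC, hu⟩ := hK z hz _ hd hdn
    have h1 : g i (z + (r / ρ) • (z - w)) ≤ |K| :=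
      (le_ciSup (hbdd _ huC) i).trans ((le_abs_self _).trans (hu.trans (le_abs_self K)))
    have h2 : -|K'| ≤ g i z := by
      have h3 := (hK' z hz 0 (Submodule.zero_mem _) (by simpa using hr'.le)).2
      rw [add_zero] at h3
      have h4 := neg_abs_le (g i0 z)
      have h5 := le_abs_self K'
      linarith [h0 i z]
    have hconv := (hg i).2 (hSC.subset hw) huC
      (by positivity : 0 ≤ r / (r + ρ)) (by positivity : 0 ≤ ρ / (r + ρ)) (by field_simp)
    have hz' : (r / (r + ρ)) • w + (ρ / (r + ρ)) • (z + (r / ρ) • (z - w)) = z := by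
      have e1 : ρ / (r + ρ) * (r / ρ) = r / (r + ρ) := by field_simp
      have e2 : ρ / (r + ρ) + r / (r + ρ) = 1 := by field_simp; ring
      rw [smul_add, smul_smul, e1]
      have : (r / (r + ρ)) • w + ((ρ / (r + ρ)) • z + (r / (r + ρ)) • (z - w))
          = (ρ / (r + ρ) + r / (r + ρ)) • z := by module
      rw [this, e2, one_smul]
    rw [hz'] at hconv
    simp only [smul_eq_mul] at hconv
    generalize g i (z + (r / ρ) • (z - w)) = U at *
    have h6 : g i z * (r + ρ) ≤ r * g i w + ρ * U := by
      have := mul_le_mul_of_nonneg_right hconv (by positivity : 0 ≤ r + ρ)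
      refine this.trans (le_of_eq ?_)
      field_simp
    rw [div_mul_eq_mul_div, le_div_iff₀ hr]
    nlinarith
  refine ⟨(|K| + |K'|) / r, by positivity, fun i z hz w hw => abs_sub_le_iff.2
    ⟨key i z hz w hw, ?_⟩⟩
  rw [norm_sub_rev]
  exact key i w hw z hz

/-! ### Packing bound and sum estimates -/

/-- Points of a set of `l_∞` diameter at most `D` with pairwise distances above `δ`. -/
theorem card_le_of_separated {ι : Type*} {n : ℕ} {D δ : ℝ} (hD : 0 ≤ D) (hδ : 0 < δ)
    (s : Finset ι) (p : ι → Fin n → ℝ) (hdiam : ∀ i ∈ s, ∀ j ∈ s, ‖p i - p j‖ ≤ D)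
    (hsep : ∀ i ∈ s, ∀ j ∈ s, i ≠ j → δ < ‖p i - p j‖) :
    (s.card : ℝ) ≤ (D / δ + 1) ^ n := by
  classical
  rcases s.eq_empty_or_nonempty with rfl | hne
  · simp only [Finset.card_empty, Nat.cast_zero]; positivity
  have hmin : ∀ c : Fin n, ∃ i ∈ s, ∀ j ∈ s, p i c ≤ p j c := fun c =>
    s.exists_min_image (fun i => p i c) hne
  choose a has ha using hmin
  have hrange : ∀ i ∈ s, ∀ c, p i c - p (a c) c ≤ D := fun i hi c =>
    ((le_abs_self _).trans (norm_le_pi_norm (p i - p (a c)) c)).trans (hdiam i hi _ (has c))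
  -- Grid of side `δ` starting at the coordinatewise minima. Two points in one cell are at sup
  -- distance at most `δ`, so separated points occupy distinct cells, of which there are `⌊D / δ⌋ +
  -- 1` per coordinate.
  let q : ι → Fin n → ℕ := fun i c => ⌊(p i c - p (a c) c) / δ⌋₊
  have hq : ∀ i ∈ s, q i ∈ Fintype.piFinset fun _ : Fin n => Finset.range (⌊D / δ⌋₊ + 1) := by
    intro i hi
    rw [Fintype.mem_piFinset]
    intro c
    rw [Finset.mem_range, Nat.lt_succ_iff]
    exact Nat.floor_le_floor (div_le_div_of_nonneg_right (hrange i hi c) hδ.le)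
  have hinj : Set.InjOn q s := by
    intro i hi j hj hij
    by_contra hne'
    refine absurd (hsep i hi j hj hne') (not_lt.2 ?_)
    rw [pi_norm_le_iff_of_nonneg hδ.le]
    intro c
    have hc : q i c = q j c := congrFun hij c
    have hi0 : 0 ≤ (p i c - p (a c) c) / δ := div_nonneg (sub_nonneg.2 (ha c i hi)) hδ.le
    have hj0 : 0 ≤ (p j c - p (a c) c) / δ := div_nonneg (sub_nonneg.2 (ha c j hj)) hδ.le
    have i1 := Nat.floor_le hi0
    have i2 := Nat.lt_floor_add_one ((p i c - p (a c) c) / δ)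
    have j1 := Nat.floor_le hj0
    have j2 := Nat.lt_floor_add_one ((p j c - p (a c) c) / δ)
    have hc' : (⌊(p i c - p (a c) c) / δ⌋₊ : ℝ) = ⌊(p j c - p (a c) c) / δ⌋₊ := by
      exact_mod_cast hc
    rw [le_div_iff₀ hδ] at i1 j1
    rw [div_lt_iff₀ hδ] at i2 j2
    rw [hc'] at i1 i2
    rw [Pi.sub_apply, Real.norm_eq_abs, abs_le]
    constructor <;> nlinarith
  have hcard := Finset.card_le_card_of_injOn q hq hinj
  rw [Fintype.card_piFinset] at hcard
  simp only [Finset.card_range, Finset.prod_const, Finset.card_univ, Fintype.card_fin] at hcard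
  calc (s.card : ℝ) ≤ ((⌊D / δ⌋₊ + 1 : ℕ) ^ n : ℕ) := by exact_mod_cast hcard
    _ = ((⌊D / δ⌋₊ : ℝ) + 1) ^ n := by push_cast; ring
    _ ≤ (D / δ + 1) ^ n := by
        have := Nat.floor_le (div_nonneg hD hδ.le)
        gcongr

theorem telescope_le {l : ℝ} (hl : 0 ≤ l) (h a e : ℕ → ℝ) {T : ℕ} (hT : 1 ≤ T)
    (hstep : ∀ t, 1 ≤ t → t < T → h t + l * a (t + 1) ≤ a t + e t) (hlast : h T ≤ a T + e T) :
    ∑ t ∈ Finset.Icc 1 T, l ^ (t - 1) * h t ≤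
      a 1 + ∑ t ∈ Finset.Icc 1 T, l ^ (t - 1) * e t := by
  -- The discounted terms `l ^ n * a (n + 1)` cancel between consecutive stages.
  have key : ∀ n, n < T → ∑ t ∈ Finset.Icc 1 n, l ^ (t - 1) * h t + l ^ n * a (n + 1) ≤
      a 1 + ∑ t ∈ Finset.Icc 1 n, l ^ (t - 1) * e t := by
    intro n
    induction n with
    | zero => intro _; simp
    | succ n ih =>
      intro hn
      have h1 := ih (by omega)
      have h2 := mul_le_mul_of_nonneg_left (hstep (n + 1) (by omega) hn) (pow_nonneg hl n)
      rw [Finset.sum_Icc_succ_top (by omega), Finset.sum_Icc_succ_top (by omega),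
        Nat.add_sub_cancel, pow_succ]
      linarith
  obtain ⟨n, rfl⟩ : ∃ n, T = n + 1 := ⟨T - 1, by omega⟩
  have h1 := key n (by omega)
  have h2 := mul_le_mul_of_nonneg_left hlast (pow_nonneg hl n)
  rw [Finset.sum_Icc_succ_top (by omega), Finset.sum_Icc_succ_top (by omega),
    Nat.add_sub_cancel]
  linarith

theorem geom_sum_le_discountMin {l : ℝ} (hl : 0 < l) (hl1 : l ≤ 1) (n : ℕ) :
    ∑ i ∈ Finset.range n, l ^ i ≤ discountMin l 1 n := by
  have hn : ∑ i ∈ Finset.range n, l ^ i ≤ n := by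
    have := Finset.sum_le_card_nsmul (Finset.range n) (fun i => l ^ i) 1
      fun i _ => pow_le_one₀ hl.le hl1
    simpa using this
  unfold discountMin
  split_ifs with h
  · exact hn
  · refine le_min ?_ hn
    have h1 : 0 < 1 - l := sub_pos.2 (lt_of_le_of_ne hl1 h)
    rw [pow_one, le_div_iff₀ h1]
    have := geom_sum_mul_neg l n
    have := pow_pos hl n
    linarith

theorem sum_succ_mul_pow_le_discountMin {l : ℝ} (hl : 0 < l) (hl1 : l ≤ 1) (n : ℕ) :
    ∑ i ∈ Finset.range n, ((i : ℝ) + 1) * l ^ i ≤ discountMin l 2 (((n : ℝ) + 1) * n / 2) := by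
  have hn : ∑ i ∈ Finset.range n, ((i : ℝ) + 1) * l ^ i ≤ ((n : ℝ) + 1) * n / 2 := by
    induction n with
    | zero => simp
    | succ n ih =>
      rw [Finset.sum_range_succ]
      have h1 : ((n : ℝ) + 1) * l ^ n ≤ ((n : ℝ) + 1) * 1 := by
        gcongr
        exact pow_le_one₀ hl.le hl1
      push_cast
      linarith
  unfold discountMin
  split_ifs with h
  · exact hn
  · refine le_min ?_ hn
    have h1 : 0 < 1 - l := sub_pos.2 (lt_of_le_of_ne hl1 h)
    rw [le_div_iff₀ (by positivity)]
    have key : (∑ i ∈ Finset.range n, ((i : ℝ) + 1) * l ^ i) * (1 - l) ^ 2 =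
        1 - (1 + n * (1 - l)) * l ^ n := by
      clear hn
      induction n with
      | zero => simp
      | succ n ih =>
        rw [Finset.sum_range_succ, add_mul, ih]
        push_cast
        ring
    rw [key]
    have := pow_pos hl n
    have : 0 ≤ (1 + n * (1 - l)) * l ^ n := by positivity
    linarith

end DDP

namespace DDP

namespace Problem

variable (P : Problem)

/-! ### Objectives and feasible sets -/

theorem objWith_coe {t : ℕ} {V : P.Dec t → EReal} {z : P.Dec t} {a : ℝ} (h : V z = (a : EReal)) :
    P.objWith t V z = ((P.h t z + P.lam * a : ℝ) : EReal) := by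
  simp [objWith, h]

theorem objWith_mono {t : ℕ} {V W : P.Dec t → EReal} {z : P.Dec t} (h : V z ≤ W z) :
    P.objWith t V z ≤ P.objWith t W z :=
  add_le_add le_rfl (mul_le_mul_of_nonneg_left h (by exact_mod_cast P.lam_pos.le))

theorem subVal_mono {t : ℕ} {F G : P.Dec (t + 1) → EReal} (h : ∀ w, F w ≤ G w) (z : P.Dec t) :
    P.subVal t F z ≤ P.subVal t G z :=
  iInf₂_mono fun w _ => h w

theorem obj_last (z : P.Dec P.T) : P.obj P.T z = (P.h P.T z : EReal) := by
  rw [obj, P.objWith_coe (a := 0) (by rw [P.value_last]; rfl)]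
  simp

theorem feas_zero (z w : P.Dec 0) : P.feas 0 z = P.feas 0 w := by
  simp [feas, P.B_zero, P.Q_zero]

/-! ### The effective feasible regions -/

/-- The graph of `feas` is convex: the equality constraint is affine in both decisions, and a convex
`phi` is compared with a linear `Q`. -/
theorem combo_mem_feas {t : ℕ} {z z' : P.Dec t} {w w' : P.Dec (t + 1)} (hw : w ∈ P.feas t z)
    (hw' : w' ∈ P.feas t z') {a b : ℝ} (ha : 0 ≤ a) (hb : 0 ≤ b) (hab : a + b = 1) :
    a • w + b • w' ∈ P.feas t (a • z + b • z') := by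
  refine ⟨P.Xbar_convex _ hw.1 hw'.1 ha hb hab, ?_, fun i => ?_⟩
  · have : P.b (t + 1) = a • P.b (t + 1) + b • P.b (t + 1) := by rw [← add_smul, hab, one_smul]
    rw [map_add, map_smul, map_smul, hw.2.1, hw'.2.1, map_add, map_smul, map_smul]
    conv_rhs => rw [this]
    simp only [smul_add]
    abel
  · refine ((P.phi_convex (t + 1) i).2 hw.1 hw'.1 ha hb hab).trans ?_
    have h1 := hw.2.2 i
    have h2 := hw'.2.2 i
    simp only [map_add, map_smul, Pi.add_apply, Pi.smul_apply, smul_eq_mul]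
    gcongr

theorem convex_effFeas (t : ℕ) : Convex ℝ (P.effFeas t) := by
  induction t with
  | zero => exact convex_univ
  | succ t ih =>
    intro w hw w' hw' a b ha hb hab
    simp only [effFeas, mem_iUnion] at hw hw' ⊢
    obtain ⟨z, hz, hw⟩ := hw
    obtain ⟨z', hz', hw'⟩ := hw'
    exact ⟨_, ih hz hz' ha hb hab, P.combo_mem_feas hw hw' ha hb hab⟩

theorem mem_effFeas_succ {t : ℕ} {z : P.Dec t} {w : P.Dec (t + 1)} (hz : z ∈ P.effFeas t)
    (hw : w ∈ P.feas t z) : w ∈ P.effFeas (t + 1) := by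
  simp only [effFeas, mem_iUnion]
  exact ⟨z, hz, hw⟩

theorem isClosed_feas_graph (t : ℕ) :
    IsClosed {q : P.Dec t × P.Dec (t + 1) | q.2 ∈ P.feas t q.1} := by
  have hA := LinearMap.continuous_of_finiteDimensional (P.A (t + 1))
  have hB := LinearMap.continuous_of_finiteDimensional (P.B t)
  have hQ := LinearMap.continuous_of_finiteDimensional (P.Q t)
  have h1 : IsClosed {q : P.Dec t × P.Dec (t + 1) | q.2 ∈ P.Xbar (t + 1)} :=
    (P.Xbar_closed (t + 1)).preimage continuous_snd
  have h2 : IsClosed {q : P.Dec t × P.Dec (t + 1) |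
      P.A (t + 1) q.2 = P.B t q.1 + P.b (t + 1)} :=
    isClosed_eq (hA.comp continuous_snd) ((hB.comp continuous_fst).add continuous_const)
  -- `phi` need not be continuous; its constraint is the preimage of the closed epigraph under `(z,
  -- w) ↦ (w, Q z)`.
  have h3 : ∀ i, IsClosed {q : P.Dec t × P.Dec (t + 1) | (q.2, P.Q t q.1 i) ∈
      epigraphOn (P.Xbar (t + 1)) (fun z => P.phi (t + 1) z i)} := fun i =>
    (P.phi_closed (t + 1) i).preimage
      (continuous_snd.prodMk ((continuous_apply i).comp (hQ.comp continuous_fst)))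
  convert (h1.inter h2).inter (isClosed_iInter h3) using 1
  ext q
  simp only [feas, epigraphOn, mem_ofPred_eq, mem_inter_iff, mem_iInter]
  grind

theorem isCompact_effFeas {D : ℕ → ℝ} (hD : P.DiameterBound D) {t : ℕ} (ht : t + 1 ≤ P.T) :
    IsCompact (P.effFeas (t + 1)) := by
  have hbd : ∀ s, 1 ≤ s → s ≤ P.T → Bornology.IsBounded (P.effFeas s) := fun s hs hsT =>
    Metric.isBounded_iff.2 ⟨D s, fun z hz w hw => by
      rw [dist_eq_norm]; exact (hD s hs hsT).2 z hz w hw⟩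
  induction t with
  | zero =>
    refine Metric.isCompact_of_isClosed_isBounded ?_ (hbd 1 le_rfl ht)
    have : P.effFeas (0 + 1) = (fun w => ((0 : P.Dec 0), w)) ⁻¹'
        {q : P.Dec 0 × P.Dec (0 + 1) | q.2 ∈ P.feas 0 q.1} := by
      ext w
      simp only [effFeas, mem_iUnion, mem_univ, exists_true_left, mem_preimage, mem_ofPred_eq]
      exact ⟨fun ⟨z, hz⟩ => P.feas_zero z 0 ▸ hz, fun h => ⟨0, h⟩⟩
    rw [this]
    exact (P.isClosed_feas_graph 0).preimage (by fun_prop)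
  | succ t ih =>
    -- The next region is so far only known to be bounded. Its closure is a compact container, so it
    -- becomes a projection of a compact piece of the closed graph.
    have hc := (ih (by omega)).prod (hbd (t + 1 + 1) (by omega) ht).isCompact_closure
    have hc' := (hc.inter_right (P.isClosed_feas_graph (t + 1))).image continuous_snd
    suffices heq : P.effFeas (t + 1 + 1) = Prod.snd '' (P.effFeas (t + 1) ×ˢ
        closure (P.effFeas (t + 1 + 1)) ∩
          {q : P.Dec (t + 1) × P.Dec (t + 1 + 1) | q.2 ∈ P.feas (t + 1) q.1}) by
      rw [heq]
      exact hc'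
    ext w
    simp only [mem_image, mem_inter_iff, mem_prod, mem_ofPred_eq, Prod.exists]
    constructor
    · intro hw
      have hw' := hw
      rw [effFeas] at hw
      simp only [mem_iUnion] at hw
      obtain ⟨z, hz, hw⟩ := hw
      exact ⟨z, w, ⟨⟨hz, subset_closure hw'⟩, hw⟩, rfl⟩
    · rintro ⟨z, w', ⟨⟨hz, -⟩, hw⟩, rfl⟩
      exact P.mem_effFeas_succ hz hw

theorem exists_pos_add_smul_mem_nhd {t : ℕ} {e : ℝ} (he : 0 < e) {z d : P.Dec t}
    (hz : z ∈ P.effFeas t) (hd : d ∈ vectorSpan ℝ (P.effFeas t)) :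
    ∃ s : ℝ, 0 < s ∧ z + s • d ∈ P.effFeasNhd t e := by
  refine ⟨e / (‖d‖ + 1), by positivity, z, hz, _, Submodule.smul_mem _ _ hd, ?_, rfl⟩
  rw [norm_smul, Real.norm_eq_abs, abs_of_pos (by positivity), div_mul_eq_mul_div,
    div_le_iff₀ (by positivity)]
  nlinarith [norm_nonneg d]

theorem relCore_hdom (hR : P.ExtendedRecourse) {t : ℕ} (ht : 1 ≤ t) (htT : t ≤ P.T) :
    RelCore (P.effFeas t) (P.hdom t) := by
  intro z hz d hd
  obtain ⟨e, he, h⟩ := hR t ht htT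
  obtain ⟨s, hs, hzs⟩ := P.exists_pos_add_smul_mem_nhd he hz hd
  exact ⟨s, hs, (h _ hzs).1⟩

theorem feas_nonempty (hR : P.ExtendedRecourse) {t : ℕ} (ht : 1 ≤ t) (htT : t < P.T) {z : P.Dec t}
    (hz : z ∈ P.effFeas t) : (P.feas t z).Nonempty := by
  obtain ⟨e, he, h⟩ := hR t ht htT.le
  refine ((h z ⟨z, hz, 0, Submodule.zero_mem _, by simpa using he.le, by simp⟩).2 htT).mono
    intrinsicInterior_subset

theorem relCore_feas_nonempty (hR : P.ExtendedRecourse) {t : ℕ} (ht : 1 ≤ t) (htT : t < P.T) :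
    RelCore (P.effFeas t) {z | (P.feas t z).Nonempty} := by
  intro z hz d hd
  obtain ⟨e, he, h⟩ := hR t ht htT.le
  obtain ⟨s, hs, hzs⟩ := P.exists_pos_add_smul_mem_nhd he hz hd
  exact ⟨s, hs, ((h _ hzs).2 htT).mono intrinsicInterior_subset⟩

end Problem

/-- A point of the relative interior can be moved inside the set in all directions of its affine
hull. -/
theorem exists_pos_add_smul_mem_of_mem_intrinsicInterior {E : Type*} [NormedAddCommGroup E]
    [NormedSpace ℝ E] {S : Set E} {z d : E} (hz : z ∈ intrinsicInterior ℝ S)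
    (hd : d ∈ vectorSpan ℝ S) : ∃ s : ℝ, 0 < s ∧ s ≤ 1 ∧ z + s • d ∈ S := by
  rw [mem_intrinsicInterior] at hz
  obtain ⟨y, hy, rfl⟩ := hz
  have hmem : ∀ s : ℝ, (y : E) + s • d ∈ affineSpan ℝ S := fun s => by
    rw [add_comm]
    refine AffineSubspace.vadd_mem_of_mem_direction ?_ y.2
    rw [direction_affineSpan]
    exact Submodule.smul_mem _ _ hd
  have hcont : Continuous fun s : ℝ => (⟨(y : E) + s • d, hmem s⟩ : affineSpan ℝ S) :=
    Continuous.subtype_mk (by fun_prop) _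
  have h0 : (fun s : ℝ => (⟨(y : E) + s • d, hmem s⟩ : affineSpan ℝ S)) 0 = y := by
    ext; simp
  have hnhds : ∀ᶠ s in nhds (0 : ℝ), (y : E) + s • d ∈ S := by
    have hy' : Subtype.val ⁻¹' S ∈
        nhds ((fun s : ℝ => (⟨(y : E) + s • d, hmem s⟩ : affineSpan ℝ S)) 0) := by
      rw [h0]
      exact mem_interior_iff_mem_nhds.1 hy
    exact hcont.continuousAt.preimage_mem_nhds hy'
  obtain ⟨r, hr, h⟩ := Metric.eventually_nhds_iff.1 hnhds
  refine ⟨min (r / 2) 1, by positivity, min_le_right _ _, h ?_⟩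
  rw [Real.dist_0_eq_abs, abs_of_pos (by positivity)]
  have := min_le_left (r / 2) 1
  linarith

namespace Problem

variable (P : Problem)

/-- Decisions that are feasible after points of the affine hull of the stage-`t` region stay in the
affine hull of the stage-`(t+1)` region. -/
theorem sub_mem_vectorSpan (hR : P.ExtendedRecourse) {t : ℕ} (ht : 1 ≤ t) (htT : t < P.T)
    {z d : P.Dec t} {w w' : P.Dec (t + 1)} (hz : z ∈ P.effFeas t)
    (hd : d ∈ vectorSpan ℝ (P.effFeas t)) (hw : w ∈ P.feas t (z + d))
    (hw' : w' ∈ P.feas t z) : w - w' ∈ vectorSpan ℝ (P.effFeas (t + 1)) := by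
  -- The point `z + d` may leave the region, but from a relative interior point `z0` one can move
  -- towards it and stay inside. Combining the feasible successors accordingly puts `w - w0` in the
  -- span.
  obtain ⟨z0, hz0⟩ := Set.Nonempty.intrinsicInterior (P.convex_effFeas t) ⟨z, hz⟩
  have hz0' := intrinsicInterior_subset hz0
  obtain ⟨w0, hw0⟩ := P.feas_nonempty hR ht htT hz0'
  have hdir : z + d - z0 ∈ vectorSpan ℝ (P.effFeas t) := by
    rw [add_sub_right_comm]
    exact Submodule.add_mem _ (vsub_mem_vectorSpan ℝ hz hz0') hd
  obtain ⟨s, hs, hs1, hzs⟩ := exists_pos_add_smul_mem_of_mem_intrinsicInterior hz0 hdir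
  have hcombo := P.combo_mem_feas hw0 hw (sub_nonneg.2 hs1) hs.le (sub_add_cancel 1 s)
  have e1 : (1 - s) • z0 + s • (z + d) = z0 + s • (z + d - z0) := by module
  have e2 : (1 - s) • w0 + s • w = w0 + s • (w - w0) := by module
  rw [e1, e2] at hcombo
  have h1 := vsub_mem_vectorSpan ℝ (P.mem_effFeas_succ hzs hcombo) (P.mem_effFeas_succ hz0' hw0)
  rw [vsub_eq_sub, add_sub_cancel_left] at h1
  have h2 := ((vectorSpan ℝ _).smul_mem_iff hs.ne').1 h1
  have h3 := vsub_mem_vectorSpan ℝ (P.mem_effFeas_succ hz0' hw0) (P.mem_effFeas_succ hz hw')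
  have h4 := Submodule.add_mem _ h2 h3
  rwa [vsub_eq_sub, sub_add_sub_cancel] at h4

/-! ### Cuts -/

/-- Weak duality: moving from `z` to `z'` changes the Lagrangian by exactly the slope term. At a `w`
feasible for `z'` the `mu` term then vanishes and the `nu` term is nonpositive. -/
theorem IsDualMultiplier.cut_le {t : ℕ} {F : P.Dec (t + 1) → EReal} {z : P.Dec t}
    {mu : Fin (P.m (t + 1)) → ℝ} {nu : Fin (P.p (t + 1)) → ℝ}
    (h : P.IsDualMultiplier t F z mu nu) (z' : P.Dec t) :
    P.subVal t F z + ((mu ⬝ᵥ P.B t (z' - z) + nu ⬝ᵥ P.Q t (z' - z) : ℝ) : EReal) ≤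
      P.subVal t F z' := by
  refine le_iInf₂ fun w hw => ?_
  rw [← h.2]
  refine (add_le_add (iInf₂_le w hw.1) le_rfl).trans ?_
  rw [add_assoc, ← EReal.coe_add]
  refine (add_le_add le_rfl (EReal.coe_le_coe_iff.2 ?_)).trans_eq
    ((congrArg (F w + ·) EReal.coe_zero).trans (add_zero _))
  have e1 : mu ⬝ᵥ (P.B t z + P.b (t + 1) - P.A (t + 1) w) + mu ⬝ᵥ P.B t (z' - z) = 0 := by
    rw [← dotProduct_add, hw.2.1, map_sub]
    convert dotProduct_zero mu using 2
    abel
  have e2 : nu ⬝ᵥ (P.Q t z - P.phi (t + 1) w) + nu ⬝ᵥ P.Q t (z' - z) =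
      nu ⬝ᵥ (P.Q t z' - P.phi (t + 1) w) := by
    rw [← dotProduct_add, map_sub]
    congr 1
    abel
  have e3 : nu ⬝ᵥ (P.Q t z' - P.phi (t + 1) w) ≤ 0 :=
    Finset.sum_nonpos fun i _ => mul_nonpos_of_nonpos_of_nonneg (h.1 i) (by
      have := hw.2.2 i
      simpa using this)
  linarith

variable {P} {x : ℕ → ∀ t, P.Dec t} {vlow : ℕ → ∀ t, P.Dec t → EReal}
  {mu : ℕ → ∀ t, Fin (P.m (t + 1)) → ℝ} {nu : ℕ → ∀ t, Fin (P.p (t + 1)) → ℝ}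

theorem IsRun.mem_effFeas (hrun : P.IsRun x vlow mu nu) (k : ℕ) {t : ℕ} (ht : t ≤ P.T) :
    x (k + 1) t ∈ P.effFeas t := by
  induction t with
  | zero => exact mem_univ _
  | succ t ih => exact P.mem_effFeas_succ (ih (by omega)) (hrun.forward_mem k t ht)

theorem IsRun.vlow_le_succ (hrun : P.IsRun x vlow mu nu) (k : ℕ) {t : ℕ} (ht : 1 ≤ t)
    (htT : t ≤ P.T) (z : P.Dec t) : vlow k t z ≤ vlow (k + 1) t z := by
  rcases htT.eq_or_lt with rfl | h
  · rw [hrun.last, hrun.last]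
  · rw [hrun.backward k t ht h]
    exact le_max_left _ _

theorem IsRun.vlow_mono (hrun : P.IsRun x vlow mu nu) {t : ℕ} (ht : 1 ≤ t)
    (htT : t ≤ P.T) (z : P.Dec t) : Monotone fun k => vlow k t z :=
  monotone_nat_of_le_succ fun k => hrun.vlow_le_succ k ht htT z

/-- The new cut is below by weak duality, and the older cuts because raising the next-stage model
only raises the right side. -/
theorem IsRun.vlow_le_subVal (hrun : P.IsRun x vlow mu nu) (k : ℕ) {t : ℕ} (ht : 1 ≤ t)
    (htT : t < P.T) (z : P.Dec t) :
    vlow k t z ≤ P.subVal t (P.objWith (t + 1) (vlow k (t + 1))) z := by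
  induction k with
  | zero => rw [hrun.init t ht htT]; exact bot_le
  | succ k ih =>
    rw [hrun.backward k t ht htT]
    refine max_le (ih.trans (P.subVal_mono (fun w => P.objWith_mono ?_) z))
      ((hrun.dual k t ht htT).cut_le P z)
    exact hrun.vlow_le_succ k (by omega) htT w

theorem IsRun.subVal_le_vlow (hrun : P.IsRun x vlow mu nu) (k : ℕ) {t : ℕ} (ht : 1 ≤ t)
    (htT : t < P.T) :
    P.subVal t (P.objWith (t + 1) (vlow (k + 1) (t + 1))) (x (k + 1) t) ≤
      vlow (k + 1) t (x (k + 1) t) := by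
  rw [hrun.backward k t ht htT]
  refine le_max_of_le_right ?_
  simp

theorem IsRun.vlow_le_value (hrun : P.IsRun x vlow mu nu) (k : ℕ) {t : ℕ} (ht : 1 ≤ t)
    (htT : t ≤ P.T) (z : P.Dec t) : vlow k t z ≤ P.value t z := by
  obtain ⟨r, hr⟩ : ∃ r, t + r = P.T := ⟨P.T - t, by omega⟩
  induction r generalizing t with
  | zero =>
    obtain rfl : t = P.T := by omega
    rw [hrun.last, P.value_last]
  | succ r ih =>
    have h : t < P.T := by omega
    rw [P.value_of_lt h]
    exact (hrun.vlow_le_subVal k ht h z).trans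
      (P.subVal_mono (fun w => P.objWith_mono (ih (by omega) (by omega) w (by omega))) z)

/-! ### Finiteness and Lipschitz continuity of the models -/

theorem exists_cut_linear (t : ℕ) (a : Fin (P.m (t + 1)) → ℝ) (c : Fin (P.p (t + 1)) → ℝ) :
    ∃ l : P.Dec t →ₗ[ℝ] ℝ, ∀ z, l z = a ⬝ᵥ P.B t z + c ⬝ᵥ P.Q t z :=
  ⟨{  toFun := fun z => a ⬝ᵥ P.B t z + c ⬝ᵥ P.Q t z
      map_add' := fun z w => by simp only [map_add, dotProduct_add]; ring
      map_smul' := fun r z => by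
        simp only [map_smul, dotProduct_smul, smul_eq_mul, RingHom.id_apply]; ring }, fun _ => rfl⟩

theorem convexOn_objective {t : ℕ} {C : Set (P.Dec t)} (hC : Convex ℝ C) (hCh : C ⊆ P.hdom t)
    {f : P.Dec t → ℝ} (hf : ConvexOn ℝ univ f) :
    ConvexOn ℝ C fun z => P.h t z + P.lam * f z :=
  ((P.h_convex t).subset hCh hC).add ((hf.subset (subset_univ _) hC).smul P.lam_pos.le)

/-- The objective is bounded below on the compact next region, and a feasible point bounds the
infimum above. Hence cuts have real constant terms. -/
theorem exists_subVal_eq_coe {D : ℕ → ℝ} (hD : P.DiameterBound D) (hR : P.ExtendedRecourse)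
    {t : ℕ} (htT : t < P.T) {V : P.Dec (t + 1) → EReal} {f : P.Dec (t + 1) → ℝ}
    (hf : ConvexOn ℝ univ f) (hV : ∀ z, V z = (f z : EReal)) {z : P.Dec t}
    (hz : z ∈ P.effFeas t) (hne : (P.feas t z).Nonempty) :
    ∃ r : ℝ, P.subVal t (P.objWith (t + 1) V) z = (r : EReal) := by
  obtain ⟨r, hr, K, hK⟩ := ConvexOn.exists_bound_nhd (P.isCompact_effFeas hD htT)
    (P.relCore_hdom hR (by omega) htT) (convexOn_objective (P.h_convex (t + 1)).1 le_rfl hf)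
  obtain ⟨w, hw⟩ := hne
  have hlow : ((-K : ℝ) : EReal) ≤ P.subVal t (P.objWith (t + 1) V) z := by
    refine le_iInf₂ fun w hw => ?_
    rw [P.objWith_coe (hV w), EReal.coe_le_coe_iff]
    have := (hK w (P.mem_effFeas_succ hz hw) 0 (Submodule.zero_mem _) (by simpa using hr.le)).2
    rw [add_zero] at this
    exact neg_le_of_abs_le this
  have hup : P.subVal t (P.objWith (t + 1) V) z ≤ ((P.h (t + 1) w + P.lam * f w : ℝ) : EReal) := by
    rw [← P.objWith_coe (hV w)]
    exact iInf₂_le w hw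
  generalize P.subVal t (P.objWith (t + 1) V) z = v at hlow hup
  induction v with
  | bot => simp at hlow
  | top => exact absurd (top_le_iff.1 hup) (EReal.coe_ne_top _)
  | coe r => exact ⟨r, rfl⟩

/-- Backwards in the stages, then forwards in the iterations. The index starts at `k + 1` because
the first cut is what replaces the initial `-∞`. -/
theorem IsRun.exists_vlow_eq_coe (hrun : P.IsRun x vlow mu nu) {D : ℕ → ℝ}
    (hD : P.DiameterBound D) (hR : P.ExtendedRecourse) {t : ℕ} (ht : 1 ≤ t) (htT : t ≤ P.T)
    (k : ℕ) : ∃ f : P.Dec t → ℝ, ConvexOn ℝ univ f ∧ ∀ z, vlow (k + 1) t z = (f z : EReal) := by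
  obtain ⟨r, hr⟩ : ∃ r, t + r = P.T := ⟨P.T - t, by omega⟩
  induction r generalizing t k with
  | zero =>
    obtain rfl : t = P.T := by omega
    exact ⟨fun _ => 0, convexOn_const 0 convex_univ, fun z => by rw [hrun.last]; rfl⟩
  | succ r ih =>
    have h : t < P.T := by omega
    have hcut : ∀ j, ∃ g : P.Dec t → ℝ, ConvexOn ℝ univ g ∧ ∀ z,
        vlow (j + 1) t z = max (vlow j t z) (g z : EReal) := by
      intro j
      obtain ⟨f, hf, hfv⟩ := ih (t := t + 1) (by omega) h j (by omega)
      obtain ⟨s, hs⟩ := exists_subVal_eq_coe hD hR h hf hfv (hrun.mem_effFeas j htT)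
        ⟨_, hrun.forward_mem j t h⟩
      obtain ⟨l, hl⟩ := exists_cut_linear (P := P) t (mu (j + 1) t) (nu (j + 1) t)
      refine ⟨fun z => (s - l (x (j + 1) t)) + l z,
        (convexOn_const _ convex_univ).add (l.convexOn convex_univ), fun z => ?_⟩
      rw [hrun.backward j t ht h, hs, ← hl, ← EReal.coe_add, map_sub]
      congr 2
      ring
    induction k with
    | zero =>
      obtain ⟨g, hg, hgv⟩ := hcut 0
      exact ⟨g, hg, fun z => by rw [hgv, hrun.init t ht h, max_eq_right bot_le]⟩
    | succ k ihk =>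
      obtain ⟨f, hf, hfv⟩ := ihk
      obtain ⟨g, hg, hgv⟩ := hcut (k + 1)
      refine ⟨f ⊔ g, hf.sup hg, fun z => ?_⟩
      rw [hgv, hfv]
      exact (EReal.coe_strictMono.monotone.map_max).symm

theorem IsRun.convex_bounded (hrun : P.IsRun x vlow mu nu) {D : ℕ → ℝ}
    (hD : P.DiameterBound D) (hR : P.ExtendedRecourse) {t : ℕ} (ht : 1 ≤ t) (htT : t ≤ P.T) :
    Convex ℝ {z | ∃ K : ℝ, ∀ k, vlow k t z ≤ (K : EReal)} := by
  rintro z ⟨K, hK⟩ w ⟨K', hK'⟩ a b ha hb hab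
  have key : ∀ k, vlow (k + 1) t (a • z + b • w) ≤ ((a * K + b * K' : ℝ) : EReal) := by
    intro k
    obtain ⟨f, hf, hfv⟩ := hrun.exists_vlow_eq_coe hD hR ht htT k
    have h1 := hK (k + 1)
    have h2 := hK' (k + 1)
    rw [hfv, EReal.coe_le_coe_iff] at h1 h2 ⊢
    refine (hf.2 (mem_univ _) (mem_univ _) ha hb hab).trans ?_
    simp only [smul_eq_mul]
    gcongr
  exact ⟨a * K + b * K', fun k => (hrun.vlow_le_succ k ht htT _).trans (key k)⟩

/-- Recourse supplies a successor `w` of `z + s • d`, where the next models may be unbounded in `k`.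
Since `w - w'` is a direction of the next region, a short step from `w'` towards `w` reaches a point
where they are bounded; it is feasible after a shorter move from `z`, and its cost bounds every
model there. -/
theorem IsRun.relCore_bounded (hrun : P.IsRun x vlow mu nu) {D : ℕ → ℝ}
    (hD : P.DiameterBound D) (hR : P.ExtendedRecourse) {t : ℕ} (ht : 1 ≤ t) (htT : t ≤ P.T) :
    RelCore (P.effFeas t) {z | ∃ K : ℝ, ∀ k, vlow k t z ≤ (K : EReal)} := by
  obtain ⟨r, hr⟩ : ∃ r, t + r = P.T := ⟨P.T - t, by omega⟩
  induction r generalizing t with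
  | zero =>
    obtain rfl : t = P.T := by omega
    exact fun z _ d _ => ⟨1, one_pos, 0, fun k => by rw [hrun.last]; rfl⟩
  | succ r ih =>
    have h : t < P.T := by omega
    intro z hz d hd
    obtain ⟨s, hs, w, hw⟩ := P.relCore_feas_nonempty hR ht h z hz d hd
    obtain ⟨w', hw'⟩ := P.feas_nonempty hR ht h hz
    have hdir := P.sub_mem_vectorSpan hR ht h hz (Submodule.smul_mem _ s hd) hw hw'
    have hcore := ih (t := t + 1) (by omega) h (by omega)
    have hw'E := P.mem_effFeas_succ hz hw'
    obtain ⟨c, hc, hcw⟩ := hcore w' hw'E _ hdir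
    have hc1 : 0 < min c 1 := lt_min hc one_pos
    obtain ⟨K, hK⟩ := Convex.add_smul_mem_of_le (hrun.convex_bounded hD hR (by omega) h)
      (hcore.subset hw'E) hc1.le (min_le_left c 1) hcw
    have hle : min c 1 ≤ 1 := min_le_right c 1
    generalize min c 1 = c' at *
    have hcombo := P.combo_mem_feas hw' hw (sub_nonneg.2 hle) hc1.le (sub_add_cancel 1 c')
    have e1 : (1 - c') • z + c' • (z + s • d) = z + (c' * s) • d := by module
    have e2 : (1 - c') • w' + c' • w = w' + c' • (w - w') := by module
    rw [e1, e2] at hcombo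
    refine ⟨c' * s, by positivity, P.h (t + 1) (w' + c' • (w - w')) + P.lam * K, fun k => ?_⟩
    refine (hrun.vlow_le_subVal k ht h _).trans ((iInf₂_le _ hcombo).trans ?_)
    rw [← P.objWith_coe (V := fun _ => (K : EReal)) (a := K) rfl]
    exact P.objWith_mono (hK k)

theorem IsRun.exists_lipschitz (hrun : P.IsRun x vlow mu nu) {D : ℕ → ℝ}
    (hD : P.DiameterBound D) (hR : P.ExtendedRecourse) {t : ℕ} (ht : 1 ≤ t) (htT : t ≤ P.T) :
    ∃ L : ℝ, 0 ≤ L ∧ ∀ k, 1 ≤ k →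
      FiniteLipschitzOn (P.objWith t (vlow k t)) (P.effFeas t) L := by
  choose f hf hfv using fun k => hrun.exists_vlow_eq_coe hD hR ht htT k
  have hcompact : IsCompact (P.effFeas t) := by
    obtain ⟨s, rfl⟩ : ∃ s, t = s + 1 := ⟨t - 1, by omega⟩
    exact P.isCompact_effFeas hD htT
  have hconv := (P.h_convex t).1.inter (hrun.convex_bounded hD hR ht htT)
  have hcore := (P.relCore_hdom hR ht htT).inter (hrun.relCore_bounded hD hR ht htT)
    (P.h_convex t).1 (hrun.convex_bounded hD hR ht htT)
  -- Index `k` stands for iteration `k + 1`; by monotonicity the model of iteration 1 is the least,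
  -- whence `i0 := 0`.
  obtain ⟨L, hL, h⟩ := ConvexOn.exists_uniform_lipschitz hcompact hcore
    (g := fun k z => P.h t z + P.lam * f k z)
    (fun k => convexOn_objective hconv inter_subset_left (hf k)) (i0 := 0)
    (fun k z => by
      have h1 := hrun.vlow_mono ht htT z (Nat.succ_le_succ (Nat.zero_le k))
      simp only [Nat.succ_eq_add_one] at h1
      rw [hfv, hfv, EReal.coe_le_coe_iff] at h1
      have := mul_le_mul_of_nonneg_left h1 P.lam_pos.le
      simpa using this)
    (by
      rintro z ⟨-, K, hK⟩
      refine ⟨P.h t z + P.lam * K, ?_⟩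
      rintro _ ⟨k, rfl⟩
      have h1 := hK (k + 1)
      rw [hfv, EReal.coe_le_coe_iff] at h1
      have := mul_le_mul_of_nonneg_left h1 P.lam_pos.le
      simpa using this)
  refine ⟨L, hL, fun k hk => ?_⟩
  obtain ⟨j, rfl⟩ : ∃ j, k = j + 1 := ⟨k - 1, by omega⟩
  exact ⟨fun z => P.h t z + P.lam * f j z, fun z _ => P.objWith_coe (hfv j z), h j⟩

theorem IsRun.exists_modelLipschitz (hrun : P.IsRun x vlow mu nu) {D : ℕ → ℝ}
    (hD : P.DiameterBound D) (hR : P.ExtendedRecourse) :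
    ∃ Mlow : ℕ → ℝ, P.ModelLipschitz vlow Mlow := by
  have h : ∀ t, ∃ L : ℝ, 1 ≤ t → t ≤ P.T → 0 ≤ L ∧ ∀ k, 1 ≤ k →
      FiniteLipschitzOn (P.objWith t (vlow k t)) (P.effFeas t) L := by
    intro t
    by_cases ht : 1 ≤ t ∧ t ≤ P.T
    · obtain ⟨L, hL⟩ := hrun.exists_lipschitz hD hR ht.1 ht.2
      exact ⟨L, fun _ _ => hL⟩
    · exact ⟨0, fun h1 h2 => absurd ⟨h1, h2⟩ ht⟩
  choose Mlow hMlow using h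
  exact ⟨Mlow, hMlow⟩

end Problem
end DDP

namespace DDP

namespace Problem

variable {P : Problem} {x : ℕ → ∀ t, P.Dec t} {vlow : ℕ → ∀ t, P.Dec t → EReal}
  {mu : ℕ → ∀ t, Fin (P.m (t + 1)) → ℝ} {nu : ℕ → ∀ t, Fin (P.p (t + 1)) → ℝ}

/-- As `λ > 0`, finiteness of `h + λ V` forces that of `V`, so saturation can be treated as an
inequality of reals. -/
theorem eq_coe_of_objWith_eq_coe {t : ℕ} {V : P.Dec t → EReal} {z : P.Dec t} {r : ℝ}
    (h : P.objWith t V z = (r : EReal)) : V z = (((r - P.h t z) / P.lam : ℝ) : EReal) := by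
  have hl := P.lam_pos
  rw [objWith] at h
  generalize V z = v at h
  induction v with
  | bot =>
    rw [EReal.coe_mul_bot_of_pos hl, EReal.add_bot] at h
    exact absurd h.symm (EReal.coe_ne_bot _)
  | top =>
    rw [EReal.coe_mul_top_of_pos hl, EReal.coe_add_top] at h
    exact absurd h.symm (EReal.coe_ne_top _)
  | coe v =>
    rw [← EReal.coe_mul, ← EReal.coe_add, EReal.coe_eq_coe_iff] at h
    rw [EReal.coe_eq_coe_iff, ← h]
    field_simp
    ring

/-! ### The tolerances -/

theorem eps_last (P : Problem) (M Mlow δ : ℕ → ℝ) : P.eps M Mlow δ (P.T - 1) = 0 := by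
  simp [eps]

theorem eps_of_lt (P : Problem) (M Mlow δ : ℕ → ℝ) {t : ℕ} (ht : 1 ≤ t) (htT : t < P.T) :
    P.eps M Mlow δ (t - 1) = (M t + Mlow t) * δ t + P.lam * P.eps M Mlow δ t := by
  obtain ⟨s, rfl⟩ : ∃ s, t = s + 1 := ⟨t - 1, by omega⟩
  rw [eps, Nat.add_sub_cancel, Finset.sum_eq_sum_Ico_succ_bot (by omega)]
  rw [eps, Finset.mul_sum, Nat.sub_self, pow_zero, mul_one]
  congr 1
  refine Finset.sum_congr rfl fun τ hτ => ?_
  rw [Finset.mem_Ico] at hτ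
  rw [show τ - s = (τ - (s + 1)) + 1 by omega, pow_succ]
  ring

/-! ### Saturated and close points -/

/-- After iteration `k`, the model at the stage-`t` search point is within `e` of the value
function. -/
def Saturated (P : Problem) (x : ℕ → ∀ t, P.Dec t) (vlow : ℕ → ∀ t, P.Dec t → EReal) (k t : ℕ)
    (e : ℝ) : Prop :=
  P.value t (x k t) ≤ vlow k t (x k t) + (e : EReal)

/-- The stage-`t` search point of iteration `k` is within distance `d` of a saturated search point
of an earlier iteration. -/
def CloseToSaturated (P : Problem) (x : ℕ → ∀ t, P.Dec t) (vlow : ℕ → ∀ t, P.Dec t → EReal)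
    (k t : ℕ) (e d : ℝ) : Prop :=
  ∃ j, 1 ≤ j ∧ j < k ∧ P.Saturated x vlow j t e ∧ ‖x k t - x j t‖ ≤ d

/-- The model used in the forward phase of iteration `k` is within `e` of the objective at the
stage-`t` search point. -/
def ObjGapLE (P : Problem) (x : ℕ → ∀ t, P.Dec t) (vlow : ℕ → ∀ t, P.Dec t → EReal) (k t : ℕ)
    (e : ℝ) : Prop :=
  P.obj t (x k t) ≤ P.objWith t (vlow (k - 1) t) (x k t) + (e : EReal)

theorem IsRun.objGapLE_last (hrun : P.IsRun x vlow mu nu) (k : ℕ) :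
    P.ObjGapLE x vlow k P.T 0 := by
  rw [ObjGapLE, P.obj_last, P.objWith_coe (a := 0) (by rw [hrun.last]; rfl)]
  simp

/-- Move to the saturated point at cost `M_t d`, replace the value by the model at cost `λ e`, and
move back at cost `Mlow_t d`. Since `j ≤ k - 1`, monotonicity carries saturation to the model of
iteration `k - 1`. -/
theorem IsRun.objGapLE_of_close (hrun : P.IsRun x vlow mu nu) {M Mlow : ℕ → ℝ}
    (hM : P.ObjLipschitz M) (hMlow : P.ModelLipschitz vlow Mlow) {k t : ℕ} (ht : 1 ≤ t)
    (htT : t < P.T) {e d : ℝ} (h : P.CloseToSaturated x vlow k t e d) :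
    P.ObjGapLE x vlow k t ((M t + Mlow t) * d + P.lam * e) := by
  obtain ⟨j, hj, hjk, hsat, hd⟩ := h
  obtain ⟨i, rfl⟩ : ∃ i, k = i + 1 := ⟨k - 1, by omega⟩
  have hk : x (i + 1) t ∈ P.effFeas t := hrun.mem_effFeas i htT.le
  have hjm : x j t ∈ P.effFeas t := by
    have := hrun.mem_effFeas (j - 1) htT.le
    rwa [Nat.sub_add_cancel hj] at this
  obtain ⟨hM0, f, hf, hfL⟩ := hM t ht htT.le
  obtain ⟨hl0, hml⟩ := hMlow t ht htT.le
  obtain ⟨g, hg, hgL⟩ := hml i (by omega)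
  have h1 := hfL _ hk _ hjm
  have h2 := hgL _ hjm _ hk
  rw [norm_sub_rev] at h2
  have hsat' : P.value t (x j t) ≤ vlow i t (x j t) + (e : EReal) :=
    hsat.trans (add_le_add (hrun.vlow_mono ht htT.le _ (by omega)) le_rfl)
  have hv := eq_coe_of_objWith_eq_coe (hf _ hjm)
  have hv' := eq_coe_of_objWith_eq_coe (hg _ hjm)
  rw [hv, hv', ← EReal.coe_add, EReal.coe_le_coe_iff] at hsat'
  have hl := P.lam_pos
  have h3 : f (x j t) - g (x j t) ≤ P.lam * e := by
    rw [div_le_iff₀ hl, add_mul, div_mul_cancel₀ _ hl.ne'] at hsat'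
    linarith
  rw [ObjGapLE, hf _ hk, Nat.add_sub_cancel, hg _ hk, ← EReal.coe_add, EReal.coe_le_coe_iff]
  have h4 := mul_le_mul_of_nonneg_left hd hM0
  have h5 := mul_le_mul_of_nonneg_left hd hl0
  have h6 := (le_abs_self _).trans h1
  have h7 := (le_abs_self _).trans h2
  linarith

theorem IsRun.objWith_le_subVal (hrun : P.IsRun x vlow mu nu) (k : ℕ) {t : ℕ} (htT : t < P.T) :
    P.objWith (t + 1) (vlow k (t + 1)) (x (k + 1) (t + 1)) ≤
      P.subVal t (P.objWith (t + 1) (vlow k (t + 1))) (x (k + 1) t) :=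
  le_iInf₂ fun _ hw => hrun.forward_min k t htT hw

/-- The forward point minimizes the old model, so its model cost is at most the minimum for the
updated model, which the new cut attains at `x k t`. -/
theorem IsRun.saturated_of_objGapLE (hrun : P.IsRun x vlow mu nu) {k t : ℕ} (hk : 1 ≤ k)
    (ht : 1 ≤ t) (htT : t < P.T) {e : ℝ} (h : P.ObjGapLE x vlow k (t + 1) e) :
    P.Saturated x vlow k t e := by
  obtain ⟨i, rfl⟩ : ∃ i, k = i + 1 := ⟨k - 1, by omega⟩
  rw [ObjGapLE, Nat.add_sub_cancel] at h
  rw [Saturated, P.value_of_lt htT]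
  refine ((iInf₂_le _ (hrun.forward_mem i t htT)).trans h).trans (add_le_add ?_ le_rfl)
  refine (hrun.objWith_le_subVal i htT).trans
    ((P.subVal_mono (fun w => P.objWith_mono ?_) _).trans (hrun.subVal_le_vlow i ht htT))
  exact hrun.vlow_le_succ i (by omega) htT w

theorem IsRun.objGapLE_of_forall_close (hrun : P.IsRun x vlow mu nu) {M Mlow δ : ℕ → ℝ}
    (hM : P.ObjLipschitz M) (hMlow : P.ModelLipschitz vlow Mlow) {k t : ℕ} (ht : 1 ≤ t)
    (htT : t ≤ P.T) (h : t < P.T → P.CloseToSaturated x vlow k t (P.eps M Mlow δ t) (δ t)) :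
    P.ObjGapLE x vlow k t (P.eps M Mlow δ (t - 1)) := by
  rcases htT.eq_or_lt with rfl | hlt
  · rw [eps_last]
    exact hrun.objGapLE_last k
  · rw [eps_of_lt P _ _ _ ht hlt]
    exact hrun.objGapLE_of_close hM hMlow ht hlt (h hlt)

/-- In every iteration either all search points are close to earlier saturated ones, or one of them
is a new saturated point far from the earlier ones. -/
theorem IsRun.exists_new_saturated (hrun : P.IsRun x vlow mu nu) {M Mlow δ : ℕ → ℝ}
    (hM : P.ObjLipschitz M) (hMlow : P.ModelLipschitz vlow Mlow) {k : ℕ} (hk : 1 ≤ k)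
    (h : ¬ ∀ t, 1 ≤ t → t < P.T → P.CloseToSaturated x vlow k t (P.eps M Mlow δ t) (δ t)) :
    ∃ t, 1 ≤ t ∧ t < P.T ∧ ¬ P.CloseToSaturated x vlow k t (P.eps M Mlow δ t) (δ t) ∧
      P.Saturated x vlow k t (P.eps M Mlow δ t) := by
  by_contra hcon
  push Not at hcon
  refine h fun t ht htT => ?_
  -- Backward induction from stage `T - 1`: closeness at `t + 1` (nothing to check if `t + 1 = T`)
  -- saturates stage `t`, so stage `t` must be close as well.
  obtain ⟨r, hr⟩ : ∃ r, t + 1 + r = P.T := ⟨P.T - (t + 1), by omega⟩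
  induction r generalizing t with
  | zero =>
    by_contra hc
    refine hcon t ht htT hc (hrun.saturated_of_objGapLE hk ht htT ?_)
    exact hrun.objGapLE_of_forall_close hM hMlow (t := t + 1) (by omega) htT fun h => by omega
  | succ r ih =>
    by_contra hc
    refine hcon t ht htT hc (hrun.saturated_of_objGapLE hk ht htT ?_)
    exact hrun.objGapLE_of_forall_close hM hMlow (t := t + 1) (by omega) htT fun h =>
      ih (t + 1) (by omega) h (by omega)

/-- Within `∑ (D_t / δ_t + 1) ^ n_t + 1` iterations all search points are close to earlier
saturated ones. -/
theorem IsRun.exists_all_close (hrun : P.IsRun x vlow mu nu) {D M Mlow δ : ℕ → ℝ}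
    (hD : P.DiameterBound D) (hM : P.ObjLipschitz M) (hMlow : P.ModelLipschitz vlow Mlow)
    (hδ : ∀ t, 1 ≤ t → t < P.T → 0 < δ t) :
    ∃ k : ℕ, 1 ≤ k ∧ (k : ℝ) ≤ (∑ t ∈ Finset.Ico 1 P.T, (D t / δ t + 1) ^ P.n t) + 1 ∧
      ∀ t, 1 ≤ t → t < P.T → P.CloseToSaturated x vlow k t (P.eps M Mlow δ t) (δ t) := by
  classical
  by_contra hcon
  push Not at hcon
  set N : ℝ := ∑ t ∈ Finset.Ico 1 P.T, (D t / δ t + 1) ^ P.n t with hN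
  have hN0 : 0 ≤ N := Finset.sum_nonneg fun t ht => by
    rw [Finset.mem_Ico] at ht
    have h1 := (hD t ht.1 ht.2.le).1
    have h2 := hδ t ht.1 ht.2
    positivity
  have hnew : ∀ k, ∃ t, k ∈ Finset.Icc 1 ⌊N + 1⌋₊ → (1 ≤ t ∧ t < P.T) ∧
      ¬ P.CloseToSaturated x vlow k t (P.eps M Mlow δ t) (δ t) ∧
      P.Saturated x vlow k t (P.eps M Mlow δ t) := by
    intro k
    by_cases hk : k ∈ Finset.Icc 1 ⌊N + 1⌋₊
    · rw [Finset.mem_Icc] at hk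
      obtain ⟨t, h1, h2, h3⟩ := hcon k hk.1 ((Nat.le_floor_iff (by positivity)).1 hk.2)
      obtain ⟨t, h1, h2, h3⟩ := hrun.exists_new_saturated (δ := δ) hM hMlow hk.1
        fun h => h3 (h t h1 h2)
      exact ⟨t, fun _ => ⟨⟨h1, h2⟩, h3⟩⟩
    · exact ⟨0, fun h => absurd h hk⟩
  choose τ hτ using hnew
  have hcard := Finset.card_eq_sum_card_fiberwise (s := Finset.Icc 1 ⌊N + 1⌋₊)
    (t := Finset.Ico 1 P.T) (f := τ) fun k hk => by
      have := (hτ k (by simpa using hk)).1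
      simpa using this
  -- Sort the first `⌊N + 1⌋` iterations by the stage of their new saturated point and apply packing
  -- to each class; the result contradicts `N < ⌊N + 1⌋`.
  have hle : ((⌊N + 1⌋₊ : ℕ) : ℝ) ≤ N := by
    have : (⌊N + 1⌋₊ : ℕ) = (Finset.Icc 1 ⌊N + 1⌋₊).card := by simp
    rw [this, hcard, Nat.cast_sum, hN]
    refine Finset.sum_le_sum fun t ht => ?_
    rw [Finset.mem_Ico] at ht
    have hDt := hD t ht.1 ht.2.le
    have hsep : ∀ i ∈ (Finset.Icc 1 ⌊N + 1⌋₊).filter (τ · = t),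
        ∀ j ∈ (Finset.Icc 1 ⌊N + 1⌋₊).filter (τ · = t), j < i → δ t < ‖x i t - x j t‖ := by
      intro i hi j hj hji
      rw [Finset.mem_filter] at hi hj
      obtain ⟨hi, rfl⟩ := hi
      obtain ⟨-, hci, -⟩ := hτ i hi
      obtain ⟨-, -, hsj⟩ := hτ j hj.1
      rw [hj.2] at hsj
      by_contra hlt
      exact hci ⟨j, (Finset.mem_Icc.1 hj.1).1, hji, hsj, not_lt.1 hlt⟩
    refine card_le_of_separated hDt.1 (hδ t ht.1 ht.2) _ (fun k => x k t) ?_ ?_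
    · intro i hi j hj
      have hmem : ∀ i, i ∈ (Finset.Icc 1 ⌊N + 1⌋₊).filter (τ · = t) → x i t ∈ P.effFeas t := by
        intro i hi
        rw [Finset.mem_filter, Finset.mem_Icc] at hi
        have := hrun.mem_effFeas (i - 1) ht.2.le
        rwa [Nat.sub_add_cancel hi.1.1] at this
      exact hDt.2 _ (hmem i hi) _ (hmem j hj)
    · intro i hi j hj hij
      rcases lt_or_gt_of_ne hij with h | h
      · rw [norm_sub_rev]
        exact hsep j hj i hi h
      · exact hsep i hi j hj h
  have := Nat.lt_floor_add_one (N + 1)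
  linarith

/-- If all search points of an iteration are close to earlier saturated ones, the iteration finds
a policy with the stated gaps. -/
theorem IsRun.findsPolicy_of_all_close (hrun : P.IsRun x vlow mu nu) {M Mlow δ : ℕ → ℝ}
    (hM : P.ObjLipschitz M) (hMlow : P.ModelLipschitz vlow Mlow) {k : ℕ} (hk : 1 ≤ k)
    (h : ∀ t, 1 ≤ t → t < P.T → P.CloseToSaturated x vlow k t (P.eps M Mlow δ t) (δ t)) :
    P.FindsPolicy x vlow k (P.eps M Mlow δ 0)
      (∑ t ∈ Finset.Icc 1 P.T, P.lam ^ (t - 1) * P.eps M Mlow δ (t - 1)) := by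
  obtain ⟨i, rfl⟩ : ∃ i, k = i + 1 := ⟨k - 1, by omega⟩
  have hgap : ∀ t, 1 ≤ t → t ≤ P.T →
      P.ObjGapLE x vlow (i + 1) t (P.eps M Mlow δ (t - 1)) := fun t ht htT =>
    hrun.objGapLE_of_forall_close hM hMlow ht htT (h t ht)
  have hreal : ∀ t, ∃ r : ℝ × ℝ, 1 ≤ t → t ≤ P.T →
      P.objWith t (vlow i t) (x (i + 1) t) = (r.1 : EReal) ∧
      P.obj t (x (i + 1) t) = (r.2 : EReal) := by
    intro t
    by_cases ht : 1 ≤ t ∧ t ≤ P.T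
    · obtain ⟨ht, htT⟩ := ht
      have hx := hrun.mem_effFeas i htT
      obtain ⟨-, f, hf, -⟩ := hM t ht htT
      -- Real values need care when `i = 0`: at stage `T` the model is identically 0, and for `t <
      -- T` closeness provides an earlier iteration, so `1 ≤ i`.
      rcases htT.eq_or_lt with rfl | hlt
      · refine ⟨(P.h P.T (x (i + 1) P.T) + P.lam * 0, f (x (i + 1) P.T)), fun _ _ =>
          ⟨P.objWith_coe (by rw [hrun.last]; rfl), hf _ hx⟩⟩
      · obtain ⟨j, hj, hji, -⟩ := h t ht hlt
        obtain ⟨g, hg, -⟩ := (hMlow t ht htT).2 i (by omega)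
        exact ⟨(g (x (i + 1) t), f (x (i + 1) t)), fun _ _ => ⟨hg _ hx, hf _ hx⟩⟩
    · exact ⟨0, fun h1 h2 => absurd ⟨h1, h2⟩ ht⟩
  choose r hr using hreal
  have hgap' : ∀ t, 1 ≤ t → t ≤ P.T → (r t).2 ≤ (r t).1 + P.eps M Mlow δ (t - 1) := by
    intro t ht htT
    have := hgap t ht htT
    rwa [ObjGapLE, Nat.add_sub_cancel, (hr t ht htT).1, (hr t ht htT).2, ← EReal.coe_add,
      EReal.coe_le_coe_iff] at this
  refine ⟨fun t ht => hrun.forward_mem i t ht, ?_, ?_⟩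
  · have h1 := hr 1 le_rfl P.one_le_T
    have hopt : ((r 1).1 : EReal) ≤ P.optVal := by
      rw [← h1.1]
      refine le_iInf₂ fun w hw => ?_
      rw [P.feas_zero 0 (x (i + 1) 0)] at hw
      exact (hrun.forward_min i 0 P.one_le_T hw).trans
        (P.objWith_mono (hrun.vlow_le_value i le_rfl P.one_le_T w))
    refine (EReal.sub_le_sub le_rfl hopt).trans ?_
    rw [h1.2, ← EReal.coe_sub, EReal.coe_le_coe_iff]
    have := hgap' 1 le_rfl P.one_le_T
    simp only [Nat.sub_self] at this
    linarith
  · rw [Nat.add_sub_cancel, (hr 1 le_rfl P.one_le_T).1, ← EReal.coe_sub, EReal.coe_le_coe_iff,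
      policyCost, sub_le_iff_le_add']
    refine telescope_le P.lam_pos.le (fun t => P.h t (x (i + 1) t)) (fun t => (r t).1)
      (fun t => P.eps M Mlow δ (t - 1)) P.one_le_T (fun t ht htT => ?_) ?_
    · refine le_trans ?_ (hgap' t ht htT.le)
      -- The next model minimum underestimates the value at `x (i + 1) t`, so `h_t` plus `λ` times
      -- it is at most the objective, hence within `ε_{t-1}` of the current model objective.
      have h1 : ((r (t + 1)).1 : EReal) ≤ P.value t (x (i + 1) t) := by
        rw [← (hr (t + 1) (by omega) htT).1, P.value_of_lt htT]
        exact (hrun.objWith_le_subVal i htT).trans (P.subVal_mono (fun w =>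
          P.objWith_mono (hrun.vlow_le_value i (by omega) htT w)) _)
      rw [eq_coe_of_objWith_eq_coe (hr t ht htT.le).2, EReal.coe_le_coe_iff,
        le_div_iff₀ P.lam_pos] at h1
      linarith
    · have h1 := hgap' P.T P.one_le_T le_rfl
      have h2 := (hr P.T P.one_le_T le_rfl).2
      rw [P.obj_last, EReal.coe_eq_coe_iff] at h2
      simpa [h2] using h1

theorem FindsPolicy.mono {k : ℕ} {g g' G G' : ℝ} (h : P.FindsPolicy x vlow k g g')
    (hg : g ≤ G) (hg' : g' ≤ G') : P.FindsPolicy x vlow k G G' :=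
  ⟨h.1, h.2.1.trans (EReal.coe_le_coe_iff.2 hg), h.2.2.trans (EReal.coe_le_coe_iff.2 hg')⟩

/-! ### Uniform tolerances -/

/-- The factor `λ ^ t` turns `λ ^ (τ - t)` into `λ ^ τ`, free of `t`, so the order of summation can
later be exchanged. -/
theorem eps_const_le (P : Problem) {M Mlow : ℕ → ℝ} {Mmax ε : ℝ} (hε : 0 < ε)
    (hM : ∀ t, 1 ≤ t → t ≤ P.T → max (M t) (Mlow t) ≤ Mmax) (t : ℕ) :
    P.lam ^ t * P.eps M Mlow (fun _ => ε) t ≤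
      2 * Mmax * ε * ∑ τ ∈ Finset.Ico t (P.T - 1), P.lam ^ τ := by
  rw [eps, Finset.mul_sum, Finset.mul_sum]
  refine Finset.sum_le_sum fun τ hτ => ?_
  rw [Finset.mem_Ico] at hτ
  have h1 := hM (τ + 1) (by omega) (by omega)
  have h2 := (le_max_left _ _).trans h1
  have h3 := (le_max_right _ _).trans h1
  have h4 : P.lam ^ τ = P.lam ^ t * P.lam ^ (τ - t) := by
    rw [← pow_add, Nat.add_sub_cancel' hτ.1]
  have h5 := P.lam_pos
  calc P.lam ^ t * ((M (τ + 1) + Mlow (τ + 1)) * ε * P.lam ^ (τ - t))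
      = (M (τ + 1) + Mlow (τ + 1)) * ε * P.lam ^ τ := by rw [h4]; ring
    _ ≤ 2 * Mmax * ε * P.lam ^ τ := by
      gcongr
      linarith

/-- Each `f τ` occurs once for every `t ≤ τ`, that is `τ + 1` times. -/
theorem sum_range_sum_Ico (f : ℕ → ℝ) (n : ℕ) :
    ∑ t ∈ Finset.range (n + 1), ∑ τ ∈ Finset.Ico t n, f τ =
      ∑ τ ∈ Finset.range n, ((τ : ℝ) + 1) * f τ := by
  induction n with
  | zero => simp
  | succ n ih =>
    rw [Finset.sum_range_succ, Finset.Ico_self, Finset.sum_empty, add_zero,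
      Finset.sum_range_succ (fun τ : ℕ => ((τ : ℝ) + 1) * f τ), ← ih]
    have : ∀ t ∈ Finset.range (n + 1), ∑ τ ∈ Finset.Ico t (n + 1), f τ =
        ∑ τ ∈ Finset.Ico t n, f τ + f n := fun t ht =>
      Finset.sum_Ico_succ_top (by rw [Finset.mem_range] at ht; omega) f
    rw [Finset.sum_congr rfl this, Finset.sum_add_distrib]
    simp

theorem eps_const_zero_le (P : Problem) {M Mlow : ℕ → ℝ} {Mmax ε : ℝ} (hε : 0 < ε)
    (hM0 : 0 ≤ Mmax) (hM : ∀ t, 1 ≤ t → t ≤ P.T → max (M t) (Mlow t) ≤ Mmax) :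
    P.eps M Mlow (fun _ => ε) 0 ≤ 2 * Mmax * discountMin P.lam 1 ((P.T : ℝ) - 1) * ε := by
  have h1 := P.eps_const_le hε hM 0
  have h2 := geom_sum_le_discountMin P.lam_pos P.lam_le_one (P.T - 1)
  rw [Nat.cast_sub P.one_le_T, Nat.cast_one] at h2
  rw [pow_zero, one_mul, ← Finset.range_eq_Ico] at h1
  refine h1.trans ?_
  rw [mul_right_comm]
  gcongr

theorem sum_eps_const_le (P : Problem) {M Mlow : ℕ → ℝ} {Mmax ε : ℝ} (hε : 0 < ε)
    (hM0 : 0 ≤ Mmax) (hM : ∀ t, 1 ≤ t → t ≤ P.T → max (M t) (Mlow t) ≤ Mmax) :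
    ∑ t ∈ Finset.Icc 1 P.T, P.lam ^ (t - 1) * P.eps M Mlow (fun _ => ε) (t - 1) ≤
      2 * Mmax * discountMin P.lam 2 ((P.T : ℝ) * ((P.T : ℝ) - 1) / 2) * ε := by
  obtain ⟨n, hn⟩ : ∃ n, P.T = n + 1 := ⟨P.T - 1, by have := P.one_le_T; omega⟩
  have h1 : ∑ t ∈ Finset.Icc 1 P.T, P.lam ^ (t - 1) * P.eps M Mlow (fun _ => ε) (t - 1) =
      ∑ t ∈ Finset.range (n + 1), P.lam ^ t * P.eps M Mlow (fun _ => ε) t := by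
    have hIcc : Finset.Icc 1 (n + 1) = Finset.Ico (0 + 1) (n + 1 + 1) := by
      ext t
      simp only [Finset.mem_Icc, Finset.mem_Ico]
      omega
    rw [Finset.range_eq_Ico, hn, hIcc]
    exact Finset.sum_Ico_add_right_sub_eq (f := fun t => P.lam ^ t * P.eps M Mlow (fun _ => ε) t)
      0 (n + 1) 1
  have h2 := sum_succ_mul_pow_le_discountMin P.lam_pos P.lam_le_one n
  rw [h1]
  refine (Finset.sum_le_sum fun t _ => P.eps_const_le hε hM t).trans ?_
  rw [← Finset.mul_sum, hn, Nat.add_sub_cancel, sum_range_sum_Ico, mul_right_comm (2 * Mmax)]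
  push_cast
  rw [add_sub_cancel_right]
  gcongr

end Problem
end DDP

/-! ### Assembly of the theorem -/

theorem mainTheorem1 (P : DDP.Problem) (D M : ℕ → ℝ)
    (hD : P.DiameterBound D) (hR : P.ExtendedRecourse) (hM : P.ObjLipschitz M)
    (x : ℕ → ∀ t, P.Dec t) (vlow : ℕ → ∀ t, P.Dec t → EReal)
    (mu : ℕ → ∀ t, Fin (P.m (t + 1)) → ℝ) (nu : ℕ → ∀ t, Fin (P.p (t + 1)) → ℝ)
    (hrun : P.IsRun x vlow mu nu) :
    (∃ Mlow : ℕ → ℝ, P.ModelLipschitz vlow Mlow) ∧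
    ∀ Mlow : ℕ → ℝ, P.ModelLipschitz vlow Mlow →
      (∀ δ : ℕ → ℝ, (∀ t, 1 ≤ t → t < P.T → 0 < δ t) →
        ∃ k : ℕ, 1 ≤ k ∧
          (k : ℝ) ≤ (∑ t ∈ Finset.Ico 1 P.T, (D t / δ t + 1) ^ P.n t) + 1 ∧
          P.FindsPolicy x vlow k (P.eps M Mlow δ 0)
            (∑ t ∈ Finset.Icc 1 P.T, P.lam ^ (t - 1) * P.eps M Mlow δ (t - 1))) ∧
      (∀ (N : ℕ) (Dmax Mmax ε : ℝ), 0 < ε →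
        (∀ t, 1 ≤ t → t ≤ P.T →
          P.n t ≤ N ∧ D t ≤ Dmax ∧ max (M t) (Mlow t) ≤ Mmax) →
        ∃ k : ℕ, 1 ≤ k ∧
          (k : ℝ) ≤ ((P.T : ℝ) - 1) * (Dmax / ε + 1) ^ N + 1 ∧
          P.FindsPolicy x vlow k
            (2 * Mmax * DDP.discountMin P.lam 1 ((P.T : ℝ) - 1) * ε)
            (2 * Mmax * DDP.discountMin P.lam 2 ((P.T : ℝ) * ((P.T : ℝ) - 1) / 2) * ε)) := by
  refine ⟨hrun.exists_modelLipschitz hD hR, fun Mlow hMlow => ?_⟩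
  have hfirst : ∀ δ : ℕ → ℝ, (∀ t, 1 ≤ t → t < P.T → 0 < δ t) →
      ∃ k : ℕ, 1 ≤ k ∧
        (k : ℝ) ≤ (∑ t ∈ Finset.Ico 1 P.T, (D t / δ t + 1) ^ P.n t) + 1 ∧
        P.FindsPolicy x vlow k (P.eps M Mlow δ 0)
          (∑ t ∈ Finset.Icc 1 P.T, P.lam ^ (t - 1) * P.eps M Mlow δ (t - 1)) := by
    intro δ hδ
    obtain ⟨k, hk, hkN, h⟩ := hrun.exists_all_close hD hM hMlow hδ
    exact ⟨k, hk, hkN, hrun.findsPolicy_of_all_close hM hMlow hk h⟩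
  refine ⟨hfirst, fun N Dmax Mmax ε hε hmax => ?_⟩
  have hMmax := fun t ht htT => (hmax t ht htT).2.2
  have hM0 : 0 ≤ Mmax :=
    ((hM 1 le_rfl P.one_le_T).1.trans (le_max_left _ _)).trans (hMmax 1 le_rfl P.one_le_T)
  obtain ⟨k, hk, hkN, h⟩ := hfirst (fun _ => ε) fun _ _ _ => hε
  refine ⟨k, hk, hkN.trans ?_, h.mono (P.eps_const_zero_le hε hM0 hMmax)
    (P.sum_eps_const_le hε hM0 hMmax)⟩
  have hterm : ∀ t ∈ Finset.Ico 1 P.T, (D t / ε + 1) ^ P.n t ≤ (Dmax / ε + 1) ^ N := by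
    intro t ht
    rw [Finset.mem_Ico] at ht
    obtain ⟨h1, h2, -⟩ := hmax t ht.1 ht.2.le
    have h3 := (hD t ht.1 ht.2.le).1
    -- This makes the base at least 1, so the exponent may be raised to `N`.
    have h4 : 0 ≤ Dmax / ε := div_nonneg (h3.trans h2) hε.le
    calc (D t / ε + 1) ^ P.n t ≤ (Dmax / ε + 1) ^ P.n t := by gcongr
      _ ≤ (Dmax / ε + 1) ^ N := pow_le_pow_right₀ (by linarith) h1
  have := Finset.sum_le_card_nsmul _ _ _ hterm
  rw [Nat.card_Ico, nsmul_eq_mul, Nat.cast_sub P.one_le_T, Nat.cast_one] at this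
  linarith
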